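/- There are numbers $\alpha_i\in\{0,1\}$, $i\ge 1$, with the following property. Let $\tilde\varepsilon_i$, $i\ge1$, be independent random variables on a probability space $(\Omega,\mathcal F,\mathsf P)$ with $\mathsf P\{\tilde\varepsilon_i=1\}=\mathsf P\{\tilde\varepsilon_i=-1\}=1/2$, and let $T_1>2\pi$. Then: (1) For every Borel set $A\subset[0,T_1]$ the series \[ \mu(A)=\sum_{i=1}^\infty \alpha_i\tilde\varepsilon_i\int_A\cos(it)\,dt \] converges almost surely, and $\mu$ is a stochastic measure on the Borel subsets of $[0,T_1]$: for pairwise disjoint Borel sets $A_1,A_2,\dots\subset[0,T_1]$, the sums $\sum_{k=1}^n\mu(A_k)$ converge in probability to $\mu\bigl(\bigcup_k A_k\bigr)$ as $n\to\infty$. (2) The process $\mu_s=\mu((0,s])=\sum_{i=1}^\infty\alpha_i\tilde\varepsilon_i\frac{\sin(is)}{i}$ (convergence almost surely for each $s$), $0\le s\le T_1$, has a version, again denoted by $\mu_s$, all of whose paths are continuous and, for every $\gamma<1/2$, Hölder continuous with exponent $\gamma$ on $[0,T_1]$. (3) For this version, almost surely, for all $0<\varepsilon\le T_1-2\pi$,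 \[ \frac1\varepsilon\int_0^{2\pi}(\mu_{s+\varepsilon}-\mu_s)^2\,ds=4\pi\sum_{i=1}^\infty\alpha_i\frac{\sin^2(i\varepsilon/2)}{i^2\varepsilon}, \] and, almost surely, this quantity has no limit, finite or infinite, as $\varepsilon\to0+$. It does not converge in probability as $\varepsilon\to0+$ either. Consequently $\mu_s$ is not a process of finite quadratic variation on $[0,2\pi]$: there is no process $V_t$, $0\le t\le 2\pi$, such that $\sup_{0\le t\le2\pi}\bigl|\frac1\varepsilon\int_0^t(\mu_{s+\varepsilon}-\mu_s)^2\,ds-V_t\bigr|\to0$ in probability as $\varepsilon\to0+$. -/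

import Mathlib

open MeasureTheory ProbabilityTheory Filter Topology Set

/-- Independent Rademacher (symmetric `±1`-valued) random variables. -/
structure IsRademacherSequence {Ω : Type*} [MeasurableSpace Ω] (P : Measure Ω)
    (r : ℕ → Ω → ℝ) : Prop where
  measurable : ∀ i, Measurable (r i)
  prob_one : ∀ i, P {ω | r i ω = 1} = 1 / 2
  prob_neg_one : ∀ i, P {ω | r i ω = -1} = 1 / 2
  indep : iIndepFun r P

/-- `μ` is a stochastic measure on the σ-algebra of measurable subsets of `S`: an `L₀`-valued set
function that is σ-additive with respect to convergence in probability.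
The values of `μ` on other sets are irrelevant. -/
def IsStochasticMeasureOn {Ω 𝕏 : Type*} [MeasurableSpace Ω] [MeasurableSpace 𝕏]
    (P : Measure Ω) (S : Set 𝕏) (μ : Set 𝕏 → Ω →ₘ[P] ℝ) : Prop :=
  ∀ A : ℕ → Set 𝕏, (∀ k, MeasurableSet (A k) ∧ A k ⊆ S) → Pairwise (Function.onFun Disjoint A) →
    TendstoInMeasure P (fun n : ℕ => ((∑ k ∈ Finset.range n, μ (A k) : Ω →ₘ[P] ℝ) : Ω → ℝ))
      atTop (μ (⋃ k, A k) : Ω → ℝ)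

/-- The regularised quadratic variation `(1/e) ∫_0^t (X_{s+e} - X_s)² ds`. -/
noncomputable def quadVar {Ω : Type*} (X : ℝ → Ω → ℝ) (t e : ℝ) (ω : Ω) : ℝ :=
  (1 / e) * ∫ s in (0 : ℝ)..t, (X (s + e) ω - X s ω) ^ 2

/-- `X` is a finite quadratic variation process on `[0, T]`: as `e → 0+`, the processes
`t ↦ (1/e) ∫_0^t (X_{s+e} - X_s)² ds` converge in probability, uniformly in `t ∈ [0, T]`. -/
def HasFiniteQuadraticVariation {Ω : Type*} [MeasurableSpace Ω] (P : Measure Ω)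
    (X : ℝ → Ω → ℝ) (T : ℝ) : Prop :=
  ∃ V : ℝ → Ω → ℝ, ∀ δ : ℝ, 0 < δ →
    Tendsto (fun e : ℝ => P {ω | ∃ t ∈ Icc 0 T, δ ≤ |quadVar X t e ω - V t ω|})
      (𝓝[>] 0) (𝓝 0)

/-! Take for `α` the indicator of the frequencies in the dyadic blocks `[2^(k²), 2^(k²+1))`. Between
consecutive blocks lie gaps whose relative length grows with `k`.

Stochastic measure: Bessel's inequality (`sum_sq_setIntegral_cos_le`) bounds the squared cosine
coefficients of an indicator by a multiple of `volume A`. The partial sums are therefore an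
`L²`-bounded martingale, and `μ A` has `L²` norm at most a constant times the square root of `volume
A`. Applied to the tails of a disjoint union, this gives σ-additivity.

Regularity: put `M = 2^(k²)`. A sub-Gaussian bound on a fine grid and Borel–Cantelli show that
almost surely block `k` is `O((k+1)/√M)` and its derivative is `O((k+1)√M)`, uniformly on compact
intervals (`IsRademacherSequence.ae_isTame`). Interpolating between the two bounds gives a Hölder
estimate of order `γ` with constant `O((k+1) M^(γ-1/2))`, which is summable for `γ < 1/2`.

Quadratic variation: an increment is a cosine series in `s + e/2`, so by Parseval its mean square no
longer depends on the signs (`IsTame.integral_sq_increment`). At `e = 2^(-k²)` block `k` alone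
contributes at least `1/π`. At `e = 2^(-(k²+k+1))`, whose inverse is the geometric mean of the two
ends of a gap, the whole series is `O(2^(-k))`. A limit, whether almost sure or in probability,
would have to be both `0` and at least `1/π`. -/

/-! ### Orthogonality of cosines and Bessel's inequality. -/

theorem integral_cos_int_mul_add (K : ℕ) {p : ℤ} (hp : p ≠ 0) (d : ℝ) :
    ∫ s in (0 : ℝ)..2 * Real.pi * K, Real.cos (p * s + d) = 0 := by
  have hp' : (p : ℝ) ≠ 0 := by exact_mod_cast hp
  have h := intervalIntegral.mul_integral_comp_mul_add (a := 0) (b := 2 * Real.pi * K)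
    (f := Real.cos) (p : ℝ) d
  rw [integral_cos] at h
  have h2 : Real.sin (p * (2 * Real.pi * K) + d) = Real.sin (p * 0 + d) := by
    have := Real.sin_add_int_mul_two_pi d (p * K)
    push_cast at this
    rw [mul_zero, zero_add, ← this]
    ring_nf
  rw [h2, sub_self] at h
  exact (mul_eq_zero.1 h).resolve_left hp'

/-- The shift `c` serves the increments over a step `e`, where `c = e / 2`; several periods are
allowed so that they can cover `[0, T₁]`. -/
theorem integral_cos_mul_cos_period (K i j : ℕ) (c : ℝ) :
    ∫ s in (0 : ℝ)..2 * Real.pi * K,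
      Real.cos (((i : ℝ) + 1) * (s + c)) * Real.cos (((j : ℝ) + 1) * (s + c)) =
      if i = j then Real.pi * K else 0 := by
  have h1 : ∀ s : ℝ, Real.cos (((i : ℝ) + 1) * (s + c)) * Real.cos (((j : ℝ) + 1) * (s + c)) =
      (1 / 2) * Real.cos (((i - j : ℤ) : ℝ) * s + (i - j) * c) +
      (1 / 2) * Real.cos (((i + j + 2 : ℤ) : ℝ) * s + (i + j + 2) * c) := by
    intro s
    have e1 : ((i - j : ℤ) : ℝ) * s + (i - j) * c
      = ((i : ℝ) + 1) * (s + c) - ((j : ℝ) + 1) * (s + c) := by push_cast; ring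
    have e2 : ((i + j + 2 : ℤ) : ℝ) * s + (i + j + 2) * c
      = ((i : ℝ) + 1) * (s + c) + ((j : ℝ) + 1) * (s + c) := by push_cast; ring
    rw [e1, e2, Real.cos_add, Real.cos_sub]
    ring
  simp_rw [h1]
  rw [intervalIntegral.integral_add, intervalIntegral.integral_const_mul,
    intervalIntegral.integral_const_mul, integral_cos_int_mul_add K (p := i + j + 2) (by omega)]
  · split_ifs with hij
    · subst hij
      simp
      ring
    · rw [integral_cos_int_mul_add K (by omega)]
      simp
  all_goals exact Continuous.intervalIntegrable (by fun_prop) _ _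

theorem integral_sq_sum_cos_period (K : ℕ) (F : Finset ℕ) (a : ℕ → ℝ) (c : ℝ) :
    ∫ s in (0 : ℝ)..2 * Real.pi * K, (∑ i ∈ F, a i * Real.cos (((i : ℝ) + 1) * (s + c))) ^ 2 =
      Real.pi * K * ∑ i ∈ F, a i ^ 2 := by
  have h : ∀ s : ℝ, (∑ i ∈ F, a i * Real.cos (((i : ℝ) + 1) * (s + c))) ^ 2 =
      ∑ i ∈ F, ∑ j ∈ F, (a i * a j) *
        (Real.cos (((i : ℝ) + 1) * (s + c)) * Real.cos (((j : ℝ) + 1) * (s + c))) := by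
    intro s
    rw [sq, Finset.sum_mul_sum]
    exact Finset.sum_congr rfl fun i _ => Finset.sum_congr rfl fun j _ => by ring
  simp_rw [h]
  rw [intervalIntegral.integral_finsetSum
    fun i _ => Continuous.intervalIntegrable (by fun_prop) _ _, Finset.mul_sum]
  refine Finset.sum_congr rfl fun i hi => ?_
  rw [intervalIntegral.integral_finsetSum
    fun i _ => Continuous.intervalIntegrable (by fun_prop) _ _]
  simp_rw [intervalIntegral.integral_const_mul, integral_cos_mul_cos_period]
  simp only [mul_ite, mul_zero, Finset.sum_ite_eq, hi, if_true]
  ring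

/-- Bessel's inequality for the cosine coefficients of an indicator function. -/
theorem sum_sq_setIntegral_cos_le (K : ℕ) (F : Finset ℕ) {A : Set ℝ}
    (hAK : A ⊆ Icc 0 (2 * Real.pi * K)) :
    ∑ i ∈ F, (∫ t in A, Real.cos (((i : ℝ) + 1) * t)) ^ 2 ≤ Real.pi * K * volume.real A := by
  set c : ℕ → ℝ := fun i => ∫ t in A, Real.cos (((i : ℝ) + 1) * t) with hc
  set Q := ∑ i ∈ F, c i ^ 2 with hQ
  have hL : 0 ≤ 2 * Real.pi * K := by positivity
  have hAfin : volume A ≠ ⊤ := ((measure_mono hAK).trans_lt measure_Icc_lt_top).ne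
  let S : ℝ → ℝ := fun t => ∑ i ∈ F, c i * Real.cos (((i : ℝ) + 1) * t)
  have hS : Continuous S := by fun_prop
  have hSi : IntegrableOn S A :=
    (hS.continuousOn.integrableOn_Icc (a := 0) (b := 2 * Real.pi * K)).mono_set hAK
  have h1 : ∫ t in A, S t = Q := by
    rw [integral_finsetSum]
    · simp_rw [integral_const_mul]
      exact Finset.sum_congr rfl fun i _ => (sq _).symm
    · intro i _
      exact (Continuous.continuousOn (by fun_prop)).integrableOn_Icc.mono_set hAK
  have h2 : ∫ t in Icc 0 (2 * Real.pi * K), S t ^ 2 = Real.pi * K * Q := by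
    rw [integral_Icc_eq_integral_Ioc, ← intervalIntegral.integral_of_le hL]
    simpa using integral_sq_sum_cos_period K F c 0
  have h3 : ∫ t in A, S t ^ 2 ≤ Real.pi * K * Q := by
    rw [← h2]
    exact setIntegral_mono_set ((hS.pow 2).continuousOn.integrableOn_Icc)
      (ae_of_all _ fun t => sq_nonneg _) hAK.eventuallyLE
  have hS2i : IntegrableOn (fun t => S t ^ 2) A :=
    ((hS.pow 2).continuousOn.integrableOn_Icc (a := 0) (b := 2 * Real.pi * K)).mono_set hAK
  -- `S / (π K)` is the projection of the indicator of `A`. Expanding this square, with `∫_A S = Q`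
  -- and `∫_A S² ≤ π K Q`, leaves `π K (π K |A| - Q) ≥ 0`.
  have h4 : 0 ≤ ∫ t in A, (S t - Real.pi * K) ^ 2 := integral_nonneg fun t => sq_nonneg _
  have h5 : ∫ t in A, (S t - Real.pi * K) ^ 2 =
      (∫ t in A, S t ^ 2) - 2 * (Real.pi * K) * Q + (Real.pi * K) ^ 2 * volume.real A := by
    have : ∀ t, (S t - Real.pi * K) ^ 2 =
      S t ^ 2 - 2 * (Real.pi * K) * S t + (Real.pi * K) ^ 2 := fun t => by ring
    simp_rw [this]
    have e1 : IntegrableOn (fun t => 2 * (Real.pi * K) * S t) A := hSi.const_mul _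
    have e2 : IntegrableOn (fun t => S t ^ 2 - 2 * (Real.pi * K) * S t) A := hS2i.sub e1
    rw [integral_add e2 (integrableOn_const hAfin), integral_sub hS2i e1, integral_const_mul, h1]
    simp [mul_comm]
  rcases Nat.eq_zero_or_pos K with rfl | hK
  · have : volume A = 0 := measure_mono_null hAK (by simp)
    simp [hQ, hc, Measure.restrict_eq_zero.2 this]
  · have hpos : 0 < Real.pi * K := by positivity
    rw [h5] at h4
    have : 0 ≤ Real.pi * K * (Real.pi * K * volume.real A - Q) := by nlinarith
    linarith [nonneg_of_mul_nonneg_right this hpos]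

/-! ### Random signs: second moments and almost sure convergence. -/

section Rademacher

variable {Ω : Type*} [MeasurableSpace Ω] {P : Measure Ω} [IsProbabilityMeasure P] {r : ℕ → Ω → ℝ}

theorem IsRademacherSequence.ae_eq_or (hr : IsRademacherSequence P r) (i : ℕ) :
    ∀ᵐ ω ∂P, r i ω = 1 ∨ r i ω = -1 := by
  have hm1 : MeasurableSet {ω | r i ω = 1} := hr.measurable i (measurableSet_singleton 1)
  have hm2 : MeasurableSet {ω | r i ω = -1} := hr.measurable i (measurableSet_singleton (-1))
  have hd : Disjoint {ω | r i ω = 1} {ω | r i ω = -1} := by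
    rw [Set.disjoint_left]
    intro ω h1 h2
    simp only [mem_ofPred_eq] at h1 h2
    linarith
  have h := measure_union hd hm2 (μ := P)
  rw [hr.prob_one, hr.prob_neg_one, ENNReal.add_halves] at h
  exact (prob_compl_eq_zero_iff (hm1.union hm2)).2 h

theorem IsRademacherSequence.integral_eq_zero (hr : IsRademacherSequence P r) (i : ℕ) :
    ∫ ω, r i ω ∂P = 0 := by
  have hm1 : MeasurableSet {ω | r i ω = 1} := hr.measurable i (measurableSet_singleton 1)
  have hm2 : MeasurableSet {ω | r i ω = -1} := hr.measurable i (measurableSet_singleton (-1))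
  have h : r i =ᵐ[P] fun ω => {ω | r i ω = 1}.indicator (fun _ => (1 : ℝ)) ω -
      {ω | r i ω = -1}.indicator (fun _ => (1 : ℝ)) ω := by
    filter_upwards [hr.ae_eq_or i] with ω hω
    rcases hω with h | h <;> simp [indicator, h] <;> norm_num
  rw [integral_congr_ae h, integral_sub ((integrable_const _).indicator hm1)
    ((integrable_const _).indicator hm2), integral_indicator_const _ hm1,
    integral_indicator_const _ hm2]
  simp [Measure.real, hr.prob_one, hr.prob_neg_one]

theorem IsRademacherSequence.memLp (hr : IsRademacherSequence P r) (i : ℕ) (p : ENNReal) :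
    MemLp (r i) p P := by
  refine MemLp.of_bound (hr.measurable i).aestronglyMeasurable 1 ?_
  filter_upwards [hr.ae_eq_or i] with ω hω
  rcases hω with h | h <;> simp [h]

theorem IsRademacherSequence.hasSubgaussianMGF (hr : IsRademacherSequence P r) (i : ℕ) :
    HasSubgaussianMGF (r i) 1 P := by
  have h := hasSubgaussianMGF_of_mem_Icc_of_integral_eq_zero (a := -1) (b := 1)
    (hr.measurable i).aemeasurable
    (by
      filter_upwards [hr.ae_eq_or i] with ω hω
      rcases hω with h | h <;> simp [h])
    (hr.integral_eq_zero i)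
  convert h
  ext
  norm_num

omit [IsProbabilityMeasure P] in
theorem IsRademacherSequence.indep_const_mul (hr : IsRademacherSequence P r) (a : ℕ → ℝ) :
    iIndepFun (fun i ω => a i * r i ω) P :=
  hr.indep.comp (fun i x => a i * x) fun i => measurable_const_mul (a i)

theorem IsRademacherSequence.memLp_sum (hr : IsRademacherSequence P r) (a : ℕ → ℝ) (F : Finset ℕ) :
    MemLp (fun ω => ∑ i ∈ F, a i * r i ω) 2 P :=
  memLp_finsetSum F fun i _ => (hr.memLp i 2).const_mul (a i)

theorem IsRademacherSequence.integral_sq_sum (hr : IsRademacherSequence P r) (a : ℕ → ℝ)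
    (F : Finset ℕ) : ∫ ω, (∑ i ∈ F, a i * r i ω) ^ 2 ∂P = ∑ i ∈ F, a i ^ 2 := by
  have hmean : ∀ i, ∫ ω, a i * r i ω ∂P = 0 := fun i => by
    rw [integral_const_mul, hr.integral_eq_zero, mul_zero]
  have h := IndepFun.variance_sum (s := F) (μ := P) (X := fun i ω => a i * r i ω)
    (fun i _ => (hr.memLp i 2).const_mul (a i))
    (fun i _ j _ hij => (hr.indep_const_mul a).indepFun hij)
  rw [variance_of_integral_eq_zero] at h
  · simp only [Finset.sum_apply] at h
    rw [h]
    refine Finset.sum_congr rfl fun i _ => ?_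
    rw [variance_of_integral_eq_zero ((hr.measurable i).const_mul _).aemeasurable (hmean i)]
    have : (fun ω => (a i * r i ω) ^ 2) =ᵐ[P] fun _ => a i ^ 2 := by
      filter_upwards [hr.ae_eq_or i] with ω hω
      rcases hω with h | h <;> simp [h]
    rw [integral_congr_ae this]
    simp
  · exact Finset.aemeasurable_sum F fun i _ => ((hr.measurable i).const_mul _).aemeasurable
  · simp only [Finset.sum_apply]
    rw [integral_finsetSum _ fun i _ => ((hr.memLp i 1).integrable le_rfl).const_mul _]
    exact Finset.sum_eq_zero fun i _ => hmean i

theorem IsRademacherSequence.eLpNorm_sum_le (hr : IsRademacherSequence P r) {a : ℕ → ℝ}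
    (F : Finset ℕ) {B : ℝ} (hB : ∑ i ∈ F, a i ^ 2 ≤ B) :
    eLpNorm (fun ω => ∑ i ∈ F, a i * r i ω) 2 P ≤ ENNReal.ofReal (Real.sqrt B) := by
  rw [(hr.memLp_sum a F).eLpNorm_eq_integral_rpow_norm (by norm_num) (by norm_num)]
  refine ENNReal.ofReal_le_ofReal ?_
  simp only [ENNReal.toReal_ofNat, Real.rpow_two, Real.norm_eq_abs, sq_abs]
  rw [hr.integral_sq_sum, Real.sqrt_eq_rpow, one_div]
  exact Real.rpow_le_rpow (Finset.sum_nonneg fun i _ => sq_nonneg _) hB (by norm_num)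

/-- The partial sums form a martingale bounded in `L²`, hence in `L¹`, so Doob's convergence theorem
applies. -/
theorem IsRademacherSequence.exists_ae_tendsto (hr : IsRademacherSequence P r) {a : ℕ → ℝ} {B : ℝ}
    (hB : ∀ n, ∑ i ∈ Finset.range n, a i ^ 2 ≤ B) :
    ∃ L : Ω → ℝ, Measurable L ∧
      (∀ᵐ ω ∂P, Tendsto (fun n : ℕ => ∑ i ∈ Finset.range n, a i * r i ω) atTop (𝓝 (L ω))) := by
  have hsm : ∀ i, StronglyMeasurable (r i) := fun i => (hr.measurable i).stronglyMeasurable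
  let ℱ := Filtration.natural r hsm
  -- The natural filtration at time `n` already contains `r n`, hence the range `n + 1`.
  let f : ℕ → Ω → ℝ := fun n ω => ∑ i ∈ Finset.range (n + 1), a i * r i ω
  have hmart : Martingale f ℱ P := by
    refine martingale_of_condExp_sub_eq_zero_nat ?_ ?_ ?_
    · intro n
      refine Finset.stronglyMeasurable_fun_sum _ fun i hi => ?_
      exact ((Filtration.stronglyAdapted_natural hsm i).mono
        (ℱ.mono (Nat.lt_succ_iff.1 (Finset.mem_range.1 hi)))).const_mul _
    · intro n
      exact (hr.memLp_sum a _).integrable (by norm_num)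
    · intro n
      have h1 : f (n + 1) - f n = a (n + 1) • r (n + 1) := by
        ext ω
        simp [f, Finset.sum_range_succ _ (n + 1)]
      rw [h1]
      refine (condExp_smul _ _ _).trans ?_
      filter_upwards [hr.indep.condExp_natural_ae_eq_of_lt hsm (Nat.lt_succ_self n)] with ω hω
      simp only [Pi.smul_apply, Pi.zero_apply]
      rw [hω, hr.integral_eq_zero, smul_zero]
  have hconv := hmart.submartingale.ae_tendsto_limitProcess (R := (Real.sqrt B).toNNReal)
    fun n => (eLpNorm_le_eLpNorm_of_exponent_le (by norm_num)
      (hr.memLp_sum a _).aestronglyMeasurable).trans (hr.eLpNorm_sum_le _ (hB _))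
  refine ⟨Filtration.limitProcess f ℱ P,
    Filtration.stronglyMeasurable_limit_process'.measurable, ?_⟩
  filter_upwards [hconv] with ω hω
  exact (tendsto_add_atTop_iff_nat 1).1 hω

/-- Fatou's lemma carries the bound on the partial sums over to the limit. -/
theorem IsRademacherSequence.eLpNorm_limit_le (hr : IsRademacherSequence P r) {a : ℕ → ℝ} {B : ℝ}
    (hB : ∀ n, ∑ i ∈ Finset.range n, a i ^ 2 ≤ B) {L : Ω → ℝ}
    (hL : ∀ᵐ ω ∂P, Tendsto (fun n : ℕ => ∑ i ∈ Finset.range n, a i * r i ω) atTop (𝓝 (L ω))) :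
    eLpNorm L 2 P ≤ ENNReal.ofReal (Real.sqrt B) := by
  refine (Lp.eLpNorm_lim_le_liminf_eLpNorm
    (fun n => (hr.memLp_sum a (Finset.range n)).aestronglyMeasurable) L hL).trans ?_
  refine (liminf_le_liminf (Eventually.of_forall fun n => hr.eLpNorm_sum_le _ (hB n))).trans ?_
  simp

end Rademacher

/-! ### Lacunary blocks and uniform bounds for their random trigonometric sums. -/

/-- The dyadic block of indices `i` with `2 ^ k² ≤ i + 1 < 2 ^ (k² + 1)`. -/
def lacunaryBlock (k : ℕ) : Finset ℕ := Finset.Ico (2 ^ k ^ 2 - 1) (2 ^ (k ^ 2 + 1) - 1)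

theorem mem_lacunaryBlock {k i : ℕ} :
    i ∈ lacunaryBlock k ↔ 2 ^ k ^ 2 ≤ i + 1 ∧ i + 1 < 2 ^ (k ^ 2 + 1) := by
  have := Nat.one_le_two_pow (n := k ^ 2)
  rw [lacunaryBlock, Finset.mem_Ico]
  omega

theorem card_lacunaryBlock (k : ℕ) : (lacunaryBlock k).card = 2 ^ k ^ 2 := by
  have := Nat.one_le_two_pow (n := k ^ 2)
  rw [lacunaryBlock, Nat.card_Ico, pow_succ]
  omega

theorem four_mul_exp_neg_two_lt_one : 4 * Real.exp (-2) < 1 := by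
  have h2 : (4 : ℝ) < Real.exp 2 := by
    have h3 := Real.exp_one_gt_d9
    have : Real.exp 2 = Real.exp 1 * Real.exp 1 := by rw [← Real.exp_add]; norm_num
    rw [this]
    nlinarith
  rw [Real.exp_neg, ← div_eq_mul_inv, div_lt_one (Real.exp_pos _)]
  exact h2

/-- The threshold `2k√M` makes the exponential `exp(-2k²)`, while the grid has `N M² + 1` points
with `M² = 4^(k²)`. The union bound is summable because `4 < e²`. -/
theorem exp_neg_sq_bound (N k : ℕ) :
    (N * ((2 ^ k ^ 2 : ℕ) : ℝ) ^ 2 + 1) *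
      (2 * Real.exp (-(2 * k * Real.sqrt ((2 ^ k ^ 2 : ℕ) : ℝ)) ^ 2 / (2 * (2 ^ k ^ 2 : ℕ)))) ≤
      2 * (N + 1) * (4 * Real.exp (-2)) ^ k := by
  have hM : (1 : ℝ) ≤ ((2 ^ k ^ 2 : ℕ) : ℝ) := by exact_mod_cast Nat.one_le_two_pow
  have hexp : -(2 * k * Real.sqrt ((2 ^ k ^ 2 : ℕ) : ℝ)) ^ 2 / (2 * (2 ^ k ^ 2 : ℕ)) =
      ((k ^ 2 : ℕ) : ℝ) * (-2) := by
    rw [mul_pow, Real.sq_sqrt (by positivity)]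
    have : ((2 ^ k ^ 2 : ℕ) : ℝ) ≠ 0 := by positivity
    field_simp
    push_cast
    ring
  have hM2 : ((2 ^ k ^ 2 : ℕ) : ℝ) ^ 2 = 4 ^ k ^ 2 := by
    push_cast
    rw [← pow_mul, mul_comm, pow_mul]
    norm_num
  have hle : (4 * Real.exp (-2)) ^ k ^ 2 ≤ (4 * Real.exp (-2)) ^ k :=
    pow_le_pow_of_le_one (by positivity) four_mul_exp_neg_two_lt_one.le
      (Nat.le_self_pow (by norm_num) k)
  rw [hexp, Real.exp_nat_mul, hM2]
  have h4 : (1 : ℝ) ≤ 4 ^ k ^ 2 := one_le_pow₀ (by norm_num)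
  calc ((N : ℝ) * 4 ^ k ^ 2 + 1) * (2 * Real.exp (-2) ^ k ^ 2)
      ≤ (N * 4 ^ k ^ 2 + 4 ^ k ^ 2) * (2 * Real.exp (-2) ^ k ^ 2) := by gcongr
    _ = 2 * (N + 1) * (4 * Real.exp (-2)) ^ k ^ 2 := by rw [mul_pow]; ring
    _ ≤ _ := by gcongr

section Rademacher

variable {Ω : Type*} [MeasurableSpace Ω] {P : Measure Ω} [IsProbabilityMeasure P] {r : ℕ → Ω → ℝ}

theorem IsRademacherSequence.measure_le_abs_sum_le (hr : IsRademacherSequence P r) (F : Finset ℕ)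
    {b : ℕ → ℝ} {v l : ℝ} (hv : 0 < v) (hb : ∑ i ∈ F, b i ^ 2 ≤ v) (hl : 0 ≤ l) :
    P {ω | l ≤ |∑ i ∈ F, b i * r i ω|} ≤ ENNReal.ofReal (2 * Real.exp (-l ^ 2 / (2 * v))) := by
  have key : ∀ b : ℕ → ℝ, ∑ i ∈ F, b i ^ 2 ≤ v →
      P {ω | l ≤ ∑ i ∈ F, b i * r i ω} ≤ ENNReal.ofReal (Real.exp (-l ^ 2 / (2 * v))) := by
    intro b hb
    have h := HasSubgaussianMGF.sum_of_iIndepFun (hr.indep_const_mul b) (s := F)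
      (fun i _ => (hr.hasSubgaussianMGF i).const_mul (b i))
    have h' : HasSubgaussianMGF (fun ω => ∑ i ∈ F, b i * r i ω) ⟨v, hv.le⟩ P :=
      ⟨h.integrable_exp_mul, fun t => (h.mgf_le t).trans <| Real.exp_le_exp.2 <| by
        rw [NNReal.coe_sum]
        gcongr
        exact (Finset.sum_le_sum fun i _ => (mul_one (b i ^ 2)).le).trans hb⟩
    rw [← ofReal_measureReal]
    exact ENNReal.ofReal_le_ofReal (h'.measure_ge_le hl)
  have hneg := key (fun i => -b i) (by simpa using hb)
  have hpos := key b hb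
  rw [two_mul, ENNReal.ofReal_add (Real.exp_pos _).le (Real.exp_pos _).le]
  refine le_trans (measure_mono ?_) ((measure_union_le _ _).trans (add_le_add hpos hneg))
  intro ω hω
  simp only [mem_ofPred_eq, neg_mul, Finset.sum_neg_distrib, mem_union] at hω ⊢
  exact le_abs.1 hω

/-- Discretisation: on a grid of mesh `1/M²`, a sum of at most `M` functions with Lipschitz constant
`2M` moves by at most `2` from a point to the grid point on its left. This is the `2` added to `l`;
the rest is a union bound over the grid. -/
theorem IsRademacherSequence.measure_exists_lt_abs_sum_le (hr : IsRademacherSequence P r)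
    (F : Finset ℕ) {M : ℕ} (hM : 0 < M) (hF : F.card ≤ M) {g : ℕ → ℝ → ℝ}
    (hg : ∀ i ∈ F, ∀ s, |g i s| ≤ 1) (hg' : ∀ i ∈ F, ∀ s t, |g i s - g i t| ≤ 2 * M * |s - t|)
    (N : ℕ) {l : ℝ} (hl : 0 ≤ l) :
    P {ω | ∃ s ∈ Icc (0 : ℝ) N, l + 2 < |∑ i ∈ F, g i s * r i ω|} ≤
      ENNReal.ofReal ((N * M ^ 2 + 1) * (2 * Real.exp (-l ^ 2 / (2 * M)))) := by
  have hM' : (0 : ℝ) < M := by exact_mod_cast hM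
  have hsub : {ω | ∃ s ∈ Icc (0 : ℝ) N, l + 2 < |∑ i ∈ F, g i s * r i ω|} ≤ᵐ[P]
      (⋃ j ∈ Finset.range (N * M ^ 2 + 1),
        {ω | l ≤ |∑ i ∈ F, g i ((j : ℝ) / M ^ 2) * r i ω|} : Set Ω) := by
    filter_upwards [ae_all_iff.2 hr.ae_eq_or] with ω hω
    rintro ⟨s, ⟨hs0, hsN⟩, hs⟩
    have hfl : (⌊s * M ^ 2⌋₊ : ℝ) ≤ s * M ^ 2 := Nat.floor_le (by positivity)
    have hfl' : s * M ^ 2 < ⌊s * M ^ 2⌋₊ + 1 := Nat.lt_floor_add_one _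
    have hj : ⌊s * M ^ 2⌋₊ ≤ N * M ^ 2 := by
      have : (⌊s * M ^ 2⌋₊ : ℝ) ≤ ((N * M ^ 2 : ℕ) : ℝ) := by
        push_cast
        exact hfl.trans (by gcongr)
      exact_mod_cast this
    refine mem_iUnion₂.2 ⟨⌊s * M ^ 2⌋₊, Finset.mem_range.2 (by omega), ?_⟩
    set t : ℝ := (⌊s * M ^ 2⌋₊ : ℝ) / M ^ 2 with ht
    have hst : |s - t| ≤ 1 / M ^ 2 := by
      have : s - t = (s * M ^ 2 - ⌊s * M ^ 2⌋₊) / M ^ 2 := by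
        rw [ht]; field_simp
      rw [this, abs_of_nonneg (div_nonneg (by linarith) (by positivity))]
      gcongr
      linarith
    have hdiff : |∑ i ∈ F, g i s * r i ω - ∑ i ∈ F, g i t * r i ω| ≤ 2 := by
      rw [← Finset.sum_sub_distrib]
      calc |∑ i ∈ F, (g i s * r i ω - g i t * r i ω)|
          ≤ ∑ i ∈ F, |g i s * r i ω - g i t * r i ω| := Finset.abs_sum_le_sum_abs _ _
        _ ≤ ∑ _i ∈ F, (2 * M * (1 / M ^ 2) : ℝ) := by
            refine Finset.sum_le_sum fun i hi => ?_
            rw [← sub_mul, abs_mul]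
            have h1 : |r i ω| = 1 := by rcases hω i with h | h <;> simp [h]
            rw [h1, mul_one]
            exact (hg' i hi s t).trans (by gcongr)
        _ = F.card * (2 / M) := by
            rw [Finset.sum_const, nsmul_eq_mul]
            field_simp
        _ ≤ M * (2 / M) := by gcongr
        _ = 2 := by field_simp
    show l ≤ |∑ i ∈ F, g i t * r i ω|
    have := abs_sub_abs_le_abs_sub (∑ i ∈ F, g i s * r i ω) (∑ i ∈ F, g i t * r i ω)
    linarith
  refine (measure_mono_ae hsub).trans ((measure_biUnion_finset_le _ _).trans ?_)
  refine (Finset.sum_le_sum fun j _ => hr.measure_le_abs_sum_le F hM' (b := fun i => g i _)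
    ?_ hl).trans ?_
  · calc ∑ i ∈ F, g i ((j : ℝ) / M ^ 2) ^ 2 ≤ ∑ i ∈ F, (1 : ℝ) := by
          refine Finset.sum_le_sum fun i hi => ?_
          rw [← sq_abs]
          exact pow_le_one₀ (abs_nonneg _) (hg i hi _)
      _ ≤ M := by
          rw [Finset.sum_const, nsmul_eq_mul, mul_one]
          exact_mod_cast hF
  · rw [Finset.sum_const, Finset.card_range, nsmul_eq_mul, ← ENNReal.ofReal_natCast,
      ← ENNReal.ofReal_mul (by positivity), Nat.cast_add, Nat.cast_mul, Nat.cast_pow, Nat.cast_one]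

/-- Borel–Cantelli over the blocks, with `M = 2^(k²)` and `l = 2k√M`. -/
theorem IsRademacherSequence.ae_eventually_abs_sum_le (hr : IsRademacherSequence P r)
    {g : ℕ → ℕ → ℝ → ℝ} (hg : ∀ k, ∀ i ∈ lacunaryBlock k, ∀ s, |g k i s| ≤ 1)
    (hg' : ∀ k, ∀ i ∈ lacunaryBlock k, ∀ s t,
      |g k i s - g k i t| ≤ 2 * (2 ^ k ^ 2 : ℕ) * |s - t|) (N : ℕ) :
    ∀ᵐ ω ∂P, ∀ᶠ k : ℕ in atTop, ∀ s ∈ Icc (0 : ℝ) N,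
      |∑ i ∈ lacunaryBlock k, g k i s * r i ω| ≤ 2 * k * Real.sqrt ((2 ^ k ^ 2 : ℕ) : ℝ) + 2 := by
  have hsum : Summable fun k : ℕ => 2 * ((N : ℝ) + 1) * (4 * Real.exp (-2)) ^ k :=
    (summable_geometric_of_lt_one (by positivity) four_mul_exp_neg_two_lt_one).mul_left _
  have h := ae_eventually_notMem (μ := P) (s := fun k : ℕ => {ω | ∃ s ∈ Icc (0 : ℝ) N,
    2 * k * Real.sqrt ((2 ^ k ^ 2 : ℕ) : ℝ) + 2 < |∑ i ∈ lacunaryBlock k, g k i s * r i ω|})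
    (ne_top_of_le_ne_top hsum.tsum_ofReal_ne_top (ENNReal.tsum_le_tsum fun k =>
      (hr.measure_exists_lt_abs_sum_le (lacunaryBlock k) (Nat.two_pow_pos _)
        (card_lacunaryBlock k).le (hg k) (hg' k) N (by positivity)).trans
        (ENNReal.ofReal_le_ofReal (exp_neg_sq_bound N k))))
  filter_upwards [h] with ω hω
  filter_upwards [hω] with k hk s hs
  by_contra hcon
  exact hk ⟨s, hs, not_le.1 hcon⟩

end Rademacher

/-- The `k`-th block of the random sine series with signs `R`. -/
noncomputable def blockSum (R : ℕ → ℝ) (k : ℕ) (s : ℝ) : ℝ :=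
  ∑ i ∈ lacunaryBlock k, R i * (Real.sin (((i : ℝ) + 1) * s) / ((i : ℝ) + 1))

/-- The signs `R` for which the blocks of the sine series and their derivatives have, on `[0, N]`,
the size that is typical for random signs. -/
def IsTame (R : ℕ → ℝ) (N : ℕ) : Prop :=
  ∃ C : ℝ, 0 ≤ C ∧ ∀ k : ℕ, ∀ s ∈ Icc (0 : ℝ) N,
    |blockSum R k s| ≤ C * ((k + 1) / Real.sqrt (2 ^ k ^ 2)) ∧
    |∑ i ∈ lacunaryBlock k, R i * Real.cos (((i : ℝ) + 1) * s)| ≤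
      C * ((k + 1) * Real.sqrt (2 ^ k ^ 2))

/-- Borel–Cantelli leaves finitely many exceptional blocks; the trivial bounds `B` let the constant
absorb them. -/
theorem exists_bound_of_eventually_bound {f : ℕ → ℝ → ℝ} {S : Set ℝ} {B h : ℕ → ℝ}
    (hB : ∀ k, ∀ s ∈ S, |f k s| ≤ B k) (hh : ∀ k, 0 < h k)
    (hev : ∀ᶠ k in atTop, ∀ s ∈ S, |f k s| ≤ h k) :
    ∃ C : ℝ, 0 ≤ C ∧ ∀ k, ∀ s ∈ S, |f k s| ≤ C * h k := by
  obtain ⟨k₀, hk₀⟩ := eventually_atTop.1 hev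
  have hnn : 0 ≤ ∑ j ∈ Finset.range k₀, |B j| / h j :=
    Finset.sum_nonneg fun j _ => div_nonneg (abs_nonneg _) (hh j).le
  refine ⟨1 + ∑ j ∈ Finset.range k₀, |B j| / h j, by positivity, fun k s hs => ?_⟩
  rcases le_or_gt k₀ k with hk | hk
  · refine (hk₀ k hk s hs).trans ?_
    nlinarith [hh k]
  · have h1 : |B k| / h k ≤ ∑ j ∈ Finset.range k₀, |B j| / h j :=
      Finset.single_le_sum (f := fun j => |B j| / h j)
        (fun j _ => div_nonneg (abs_nonneg _) (hh j).le) (Finset.mem_range.2 hk)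
    calc |f k s| ≤ |B k| := (hB k s hs).trans (le_abs_self _)
      _ = |B k| / h k * h k := by rw [div_mul_cancel₀ _ (hh k).ne']
      _ ≤ _ := mul_le_mul_of_nonneg_right (by linarith) (hh k).le

theorem IsRademacherSequence.ae_isTame {Ω : Type*} [MeasurableSpace Ω] {P : Measure Ω}
    [IsProbabilityMeasure P] {r : ℕ → Ω → ℝ} (hr : IsRademacherSequence P r) (N : ℕ) :
    ∀ᵐ ω ∂P, IsTame (fun i => r i ω) N := by
  have hlip : ∀ k, ∀ i ∈ lacunaryBlock k, ((i : ℝ) + 1) ≤ 2 * (2 ^ k ^ 2 : ℕ) := by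
    intro k i hi
    have h := (mem_lacunaryBlock.1 hi).2.le
    rw [pow_succ, mul_comm] at h
    exact_mod_cast h
  have hlow : ∀ k, ∀ i ∈ lacunaryBlock k, ((2 ^ k ^ 2 : ℕ) : ℝ) ≤ (i : ℝ) + 1 := by
    intro k i hi
    exact_mod_cast (mem_lacunaryBlock.1 hi).1
  have hcos := hr.ae_eventually_abs_sum_le (g := fun _ i s => Real.cos (((i : ℝ) + 1) * s))
    (fun k i hi s => Real.abs_cos_le_one _)
    (fun k i hi s t => by
      refine (Real.abs_cos_sub_cos_le _ _).trans ?_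
      rw [← mul_sub, abs_mul, abs_of_pos (by positivity : (0 : ℝ) < (i : ℝ) + 1)]
      gcongr
      exact hlip k i hi) N
  -- Scaling by `2^(k²)`, the least frequency of the block, brings the coefficients below `1`; the
  -- factor is divided out again below.
  have hsin := hr.ae_eventually_abs_sum_le
    (g := fun k i s => (2 ^ k ^ 2 : ℕ) * (Real.sin (((i : ℝ) + 1) * s) / ((i : ℝ) + 1)))
    (fun k i hi s => by
      have hi0 : (0 : ℝ) < (i : ℝ) + 1 := by positivity
      rw [abs_mul, abs_div, abs_of_pos hi0, Nat.abs_cast, mul_div_assoc', div_le_one hi0]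
      calc ((2 ^ k ^ 2 : ℕ) : ℝ) * |Real.sin (((i : ℝ) + 1) * s)| ≤ (2 ^ k ^ 2 : ℕ) * 1 := by
            gcongr
            exact Real.abs_sin_le_one _
        _ ≤ _ := by rw [mul_one]; exact hlow k i hi)
    (fun k i hi s t => by
      have hi0 : (0 : ℝ) < (i : ℝ) + 1 := by positivity
      rw [← mul_sub, ← sub_div, abs_mul, abs_div, abs_of_pos hi0, Nat.abs_cast]
      have h1 : |Real.sin (((i : ℝ) + 1) * s) - Real.sin (((i : ℝ) + 1) * t)| ≤
          ((i : ℝ) + 1) * |s - t| := by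
        refine (Real.abs_sin_sub_sin_le _ _).trans ?_
        rw [← mul_sub, abs_mul, abs_of_pos hi0]
      calc ((2 ^ k ^ 2 : ℕ) : ℝ) *
            (|Real.sin (((i : ℝ) + 1) * s) - Real.sin (((i : ℝ) + 1) * t)| / ((i : ℝ) + 1))
          ≤ (2 ^ k ^ 2 : ℕ) * |s - t| := by
            gcongr
            rw [div_le_iff₀ hi0]
            linarith
        _ ≤ _ := by
            gcongr
            have : (0 : ℝ) ≤ (2 ^ k ^ 2 : ℕ) := by positivity
            linarith) N
  filter_upwards [hcos, hsin, ae_all_iff.2 hr.ae_eq_or] with ω h1 h2 hω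
  have hone : ∀ k : ℕ, (1 : ℝ) ≤ Real.sqrt (2 ^ k ^ 2) := fun k => by
    rw [Real.one_le_sqrt]
    exact one_le_pow₀ (by norm_num)
  have hsize : ∀ k : ℕ, 2 * k * Real.sqrt ((2 ^ k ^ 2 : ℕ) : ℝ) + 2 ≤
      2 * ((k + 1) * Real.sqrt (2 ^ k ^ 2)) := fun k => by
    push_cast
    linarith [hone k]
  have habs : ∀ i, |r i ω| ≤ 1 := fun i => by rcases hω i with h | h <;> simp [h]
  obtain ⟨C₁, hC₁, hC₁'⟩ := exists_bound_of_eventually_bound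
    (f := fun k s => ∑ i ∈ lacunaryBlock k, r i ω * Real.cos (((i : ℝ) + 1) * s))
    (S := Icc (0 : ℝ) N) (B := fun k => ∑ i ∈ lacunaryBlock k, 1)
    (h := fun k => 2 * ((k + 1) * Real.sqrt (2 ^ k ^ 2)))
    (fun k s _ => (Finset.abs_sum_le_sum_abs _ _).trans <| Finset.sum_le_sum fun i _ => by
      rw [abs_mul]
      exact mul_le_one₀ (habs i) (abs_nonneg _) (Real.abs_cos_le_one _))
    (fun k => by positivity)
    (by
      filter_upwards [h1] with k hk s hs
      refine le_trans (le_of_eq ?_) ((hk s hs).trans (hsize k))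
      simp_rw [mul_comm])
  obtain ⟨C₂, hC₂, hC₂'⟩ := exists_bound_of_eventually_bound
    (f := fun k s => blockSum (fun i => r i ω) k s)
    (S := Icc (0 : ℝ) N) (B := fun k => ∑ i ∈ lacunaryBlock k, 1)
    (h := fun k => 2 * ((k + 1) / Real.sqrt (2 ^ k ^ 2)))
    (fun k s _ => (Finset.abs_sum_le_sum_abs _ _).trans <| Finset.sum_le_sum fun i _ => by
      rw [abs_mul]
      refine mul_le_one₀ (habs i) (abs_nonneg _) ?_
      rw [abs_div, abs_of_pos (by positivity : (0 : ℝ) < (i : ℝ) + 1), div_le_one (by positivity)]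
      exact (Real.abs_sin_le_one _).trans (by linarith [(Nat.cast_nonneg i : (0 : ℝ) ≤ i)]))
    (fun k => by positivity)
    (by
      filter_upwards [h2] with k hk s hs
      have h := (hk s hs).trans (hsize k)
      have heq : ∑ i ∈ lacunaryBlock k,
          ((2 ^ k ^ 2 : ℕ) * (Real.sin (((i : ℝ) + 1) * s) / ((i : ℝ) + 1))) * r i ω =
          2 ^ k ^ 2 * blockSum (fun i => r i ω) k s := by
        rw [blockSum, Finset.mul_sum]
        refine Finset.sum_congr rfl fun i _ => ?_
        push_cast
        ring
      have hM : (0 : ℝ) < 2 ^ k ^ 2 := by positivity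
      rw [heq, abs_mul, abs_of_pos hM] at h
      have hsq := Real.mul_self_sqrt hM.le
      have h0 : 0 < Real.sqrt (2 ^ k ^ 2) := by positivity
      rw [mul_div_assoc', le_div_iff₀ h0]
      rw [← hsq] at h
      refine le_of_mul_le_mul_right ?_ h0
      rw [Real.sqrt_mul_self h0.le] at h
      nlinarith)
  refine ⟨2 * C₁ + 2 * C₂, by positivity, fun k s hs => ⟨?_, ?_⟩⟩
  · refine (hC₂' k s hs).trans ?_
    have : 0 ≤ ((k : ℝ) + 1) / Real.sqrt (2 ^ k ^ 2) := by positivity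
    nlinarith [mul_nonneg hC₁ this]
  · refine (hC₁' k s hs).trans ?_
    have : 0 ≤ ((k : ℝ) + 1) * Real.sqrt (2 ^ k ^ 2) := by positivity
    nlinarith [mul_nonneg hC₂ this]

/-! ### Hölder continuity of tame series. -/

theorem summable_block_rpow {γ : ℝ} (hγ : γ < 1 / 2) :
    Summable fun k : ℕ => ((k : ℝ) + 1) * Real.sqrt (2 ^ k ^ 2) ^ (-(1 - 2 * γ)) := by
  set q : ℝ := 2 ^ (-(1 / 2 - γ)) with hq
  have hq0 : 0 < q := by positivity
  have hq1 : q < 1 := Real.rpow_lt_one_of_one_lt_of_neg (by norm_num) (by linarith)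
  have hs : Summable fun k : ℕ => ((k : ℝ) + 1) * q ^ k := by
    have h1 := summable_pow_mul_geometric_of_norm_lt_one 1 (r := q)
      (by rwa [Real.norm_of_nonneg hq0.le])
    have h2 := summable_geometric_of_lt_one hq0.le hq1
    refine (h1.add h2).congr fun k => ?_
    ring
  refine Summable.of_nonneg_of_le (fun k => by positivity) (fun k => ?_) hs
  gcongr
  have hM : Real.sqrt (2 ^ k ^ 2) ^ (-(1 - 2 * γ)) = q ^ (k ^ 2) := by
    rw [Real.sqrt_eq_rpow, ← Real.rpow_mul (by positivity), hq, ← Real.rpow_natCast (2 : ℝ),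
      ← Real.rpow_mul (by norm_num), ← Real.rpow_natCast, ← Real.rpow_mul (by norm_num)]
    congr 1
    ring
  rw [hM]
  exact pow_le_pow_of_le_one hq0.le hq1.le (Nat.le_self_pow (by norm_num) k)

theorem summable_block_inv_sqrt :
    Summable fun k : ℕ => ((k : ℝ) + 1) / Real.sqrt (2 ^ k ^ 2) := by
  refine (summable_block_rpow (γ := 0) (by norm_num)).congr fun k => ?_
  rw [mul_zero, sub_zero, Real.rpow_neg_one, div_eq_mul_inv]

theorem IsTame.summable_blockSum {R : ℕ → ℝ} {N : ℕ} (h : IsTame R N) {s : ℝ}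
    (hs : s ∈ Icc (0 : ℝ) N) : Summable fun k => blockSum R k s := by
  obtain ⟨C, -, h⟩ := h
  exact Summable.of_norm_bounded (summable_block_inv_sqrt.mul_left C) fun k => (h k s hs).1

theorem hasDerivAt_blockSum (R : ℕ → ℝ) (k : ℕ) (s : ℝ) :
    HasDerivAt (blockSum R k) (∑ i ∈ lacunaryBlock k, R i * Real.cos (((i : ℝ) + 1) * s)) s := by
  refine HasDerivAt.fun_sum fun i _ => ?_
  have hi : ((i : ℝ) + 1) ≠ 0 := by positivity
  have h := (((hasDerivAt_id s).const_mul ((i : ℝ) + 1)).sin.div_const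
    ((i : ℝ) + 1)).const_mul (R i)
  simp only [id, mul_one, mul_div_cancel_right₀ _ hi] at h
  exact h

theorem interpolation_le {x A D γ : ℝ} (hx : 0 ≤ x) (hA : x ≤ A) (hD : x ≤ D) (h0 : 0 ≤ γ)
    (h1 : γ ≤ 1) : x ≤ A ^ (1 - γ) * D ^ γ := by
  calc x = x ^ (1 - γ) * x ^ γ := by
        rw [← Real.rpow_add' hx (by norm_num), sub_add_cancel, Real.rpow_one]
    _ ≤ A ^ (1 - γ) * D ^ γ := by
        have := sub_nonneg.2 h1
        gcongr
        exact Real.rpow_nonneg (hx.trans hA) _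

/-- For each block, the sup bound and the mean value bound are interpolated with weights `1 - γ` and
`γ`; the resulting Hölder constants are summed by `summable_block_rpow`. -/
theorem IsTame.exists_holderOnWith {R : ℕ → ℝ} {N : ℕ} (h : IsTame R N) {γ : NNReal}
    (hγ : γ < 1 / 2) :
    ∃ C : NNReal, HolderOnWith C γ (fun s => ∑' k, blockSum R k s) (Icc 0 N) := by
  have hsummable := fun s hs => h.summable_blockSum (s := s) hs
  obtain ⟨C, hC, h⟩ := h
  have hγ' : (γ : ℝ) < 1 / 2 := by exact_mod_cast hγ
  have hsum := (summable_block_rpow hγ').mul_left (2 * C)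
  set u : ℕ → ℝ := fun k => 2 * C * (((k : ℝ) + 1) * Real.sqrt (2 ^ k ^ 2) ^ (-(1 - 2 * (γ : ℝ))))
    with hu
  have hu0 : ∀ k, 0 ≤ u k := fun k => by positivity
  have hblock : ∀ k, ∀ s ∈ Icc (0 : ℝ) N, ∀ t ∈ Icc (0 : ℝ) N,
      |blockSum R k s - blockSum R k t| ≤ u k * |s - t| ^ (γ : ℝ) := by
    intro k s hs t ht
    have hW : 0 < Real.sqrt (2 ^ k ^ 2) := by positivity
    have hA : |blockSum R k s - blockSum R k t| ≤ 2 * C * (k + 1) * (Real.sqrt (2 ^ k ^ 2))⁻¹ := by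
      refine (abs_sub _ _).trans ?_
      have := (h k s hs).1
      have := (h k t ht).1
      rw [div_eq_mul_inv] at *
      linarith
    have hD : |blockSum R k s - blockSum R k t| ≤
        2 * C * (k + 1) * (Real.sqrt (2 ^ k ^ 2) * |s - t|) := by
      have := (convex_Icc (0 : ℝ) N).norm_image_sub_le_of_norm_hasDerivWithin_le
        (fun x _ => (hasDerivAt_blockSum R k x).hasDerivWithinAt)
        (fun x hx => (h k x hx).2) ht hs
      simp only [Real.norm_eq_abs] at this
      refine this.trans ?_
      have : 0 ≤ C * ((k + 1) * Real.sqrt (2 ^ k ^ 2)) * |s - t| := by positivity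
      linarith
    refine (interpolation_le (abs_nonneg _) hA hD γ.coe_nonneg (by linarith : (γ : ℝ) ≤ 1)).trans
      (le_of_eq ?_)
    have hE : 0 ≤ 2 * C * ((k : ℝ) + 1) := by positivity
    rw [Real.mul_rpow hE (by positivity), Real.mul_rpow hE (by positivity),
      Real.mul_rpow hW.le (abs_nonneg _), hu, Real.inv_rpow hW.le, ← Real.rpow_neg hW.le]
    have e1 : (2 * C * ((k : ℝ) + 1)) ^ (1 - (γ : ℝ)) * (2 * C * ((k : ℝ) + 1)) ^ (γ : ℝ) =
        2 * C * ((k : ℝ) + 1) := by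
      rw [← Real.rpow_add' hE (by norm_num), sub_add_cancel, Real.rpow_one]
    have e2 : Real.sqrt (2 ^ k ^ 2) ^ (-(1 - (γ : ℝ))) * Real.sqrt (2 ^ k ^ 2) ^ (γ : ℝ) =
        Real.sqrt (2 ^ k ^ 2) ^ (-(1 - 2 * (γ : ℝ))) := by
      rw [← Real.rpow_add hW]
      congr 1
      ring
    calc _ = ((2 * C * ((k : ℝ) + 1)) ^ (1 - (γ : ℝ)) * (2 * C * ((k : ℝ) + 1)) ^ (γ : ℝ)) *
          (Real.sqrt (2 ^ k ^ 2) ^ (-(1 - (γ : ℝ))) * Real.sqrt (2 ^ k ^ 2) ^ (γ : ℝ)) *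
          |s - t| ^ (γ : ℝ) := by ring
      _ = _ := by rw [e1, e2]; ring
  have hdist : ∀ s ∈ Icc (0 : ℝ) N, ∀ t ∈ Icc (0 : ℝ) N,
      |∑' k, blockSum R k s - ∑' k, blockSum R k t| ≤ (∑' k, u k) * |s - t| ^ (γ : ℝ) := by
    intro s hs t ht
    rw [← (hsummable s hs).tsum_sub (hsummable t ht), ← tsum_mul_right]
    exact tsum_of_norm_bounded (f := fun k => blockSum R k s - blockSum R k t)
      (hsum.mul_right _).hasSum fun k => hblock k s hs t ht
  refine ⟨(∑' k, u k).toNNReal, fun s hs t ht => ?_⟩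
  simp only [edist_dist, Real.dist_eq]
  rw [ENNReal.ofReal_rpow_of_nonneg (abs_nonneg _) γ.coe_nonneg, ← ENNReal.ofReal_coe_nnreal,
    ← ENNReal.ofReal_mul (NNReal.coe_nonneg _), Real.coe_toNNReal _ (tsum_nonneg hu0)]
  exact ENNReal.ofReal_le_ofReal (hdist s hs t ht)

/-! ### The coefficients and the oscillation of the quadratic variation series. -/

open Classical in
/-- The indicator of the union of the blocks: the coefficients `α`. -/
noncomputable def lacunaryCoeff (i : ℕ) : ℝ := if ∃ k, i ∈ lacunaryBlock k then 1 else 0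

theorem lacunaryCoeff_eq_zero_or_one (i : ℕ) : lacunaryCoeff i = 0 ∨ lacunaryCoeff i = 1 := by
  unfold lacunaryCoeff
  split_ifs <;> simp

theorem lacunaryCoeff_sq (i : ℕ) : lacunaryCoeff i ^ 2 = lacunaryCoeff i := by
  rcases lacunaryCoeff_eq_zero_or_one i with h | h <;> simp [h]

theorem lacunaryCoeff_nonneg (i : ℕ) : 0 ≤ lacunaryCoeff i := by
  rcases lacunaryCoeff_eq_zero_or_one i with h | h <;> simp [h]

theorem lacunaryCoeff_le_one (i : ℕ) : lacunaryCoeff i ≤ 1 := by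
  rcases lacunaryCoeff_eq_zero_or_one i with h | h <;> simp [h]

theorem lacunaryCoeff_of_mem {k i : ℕ} (h : i ∈ lacunaryBlock k) : lacunaryCoeff i = 1 :=
  if_pos ⟨k, h⟩

theorem lacunaryCoeff_of_gap {k i : ℕ} (h1 : 2 ^ (k ^ 2 + 1) ≤ i + 1)
    (h2 : i + 1 < 2 ^ (k + 1) ^ 2) : lacunaryCoeff i = 0 := by
  refine if_neg ?_
  rintro ⟨j, hj⟩
  rw [mem_lacunaryBlock] at hj
  have h3 : k ^ 2 + 1 < j ^ 2 + 1 :=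
    (Nat.pow_lt_pow_iff_right (by norm_num : 1 < 2)).1 (h1.trans_lt hj.2)
  have h4 : j ^ 2 < (k + 1) ^ 2 :=
    (Nat.pow_lt_pow_iff_right (by norm_num : 1 < 2)).1 (hj.1.trans_lt h2)
  have h5 : k < j := lt_of_pow_lt_pow_left₀ 2 (Nat.zero_le _) (by omega)
  have h6 : j < k + 1 := lt_of_pow_lt_pow_left₀ 2 (Nat.zero_le _) h4
  omega

/-- Sums over blocks are a subsequence of the ordinary partial sums, so the block series and the
original series have the same limit when both converge. -/
theorem sum_range_lacunaryCoeff_mul (x : ℕ → ℝ) (K : ℕ) :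
    ∑ i ∈ Finset.range (2 ^ K ^ 2 - 1), lacunaryCoeff i * x i =
      ∑ k ∈ Finset.range K, ∑ i ∈ lacunaryBlock k, x i := by
  induction K with
  | zero => simp
  | succ k ih =>
    have h1 : 1 ≤ 2 ^ k ^ 2 := Nat.one_le_two_pow
    have h2 : 2 ^ k ^ 2 ≤ 2 ^ (k ^ 2 + 1) := Nat.pow_le_pow_right (by norm_num) (by omega)
    have h3 : 2 ^ (k ^ 2 + 1) ≤ 2 ^ (k + 1) ^ 2 :=
      Nat.pow_le_pow_right (by norm_num) (by rw [add_sq]; omega)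
    rw [Finset.sum_range_succ, ← ih, ← Finset.sum_range_add_sum_Ico _
      (show 2 ^ k ^ 2 - 1 ≤ 2 ^ (k + 1) ^ 2 - 1 by omega)]
    congr 1
    have hsub : lacunaryBlock k ⊆ Finset.Ico (2 ^ k ^ 2 - 1) (2 ^ (k + 1) ^ 2 - 1) :=
      Finset.Ico_subset_Ico le_rfl (by omega)
    rw [← Finset.sum_subset hsub]
    · exact Finset.sum_congr rfl fun i hi => by rw [lacunaryCoeff_of_mem hi, one_mul]
    · intro i hi hni
      rw [Finset.mem_Ico] at hi
      rw [mem_lacunaryBlock] at hni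
      rw [lacunaryCoeff_of_gap (k := k) (by omega) (by omega), zero_mul]

theorem tendsto_two_pow_sq_sub_one : Tendsto (fun K : ℕ => 2 ^ K ^ 2 - 1) atTop atTop := by
  refine tendsto_atTop_mono (fun K => ?_) tendsto_id
  have h1 : K ≤ K ^ 2 := Nat.le_self_pow (by norm_num) K
  have h2 : K ^ 2 < 2 ^ K ^ 2 := Nat.lt_two_pow_self
  simp only [id]
  omega

/-- The terms of the quadratic variation of the random series. -/
noncomputable def quadVarTerm (e : ℝ) (i : ℕ) : ℝ :=
  4 * Real.pi * (lacunaryCoeff i *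
    (Real.sin (((i : ℝ) + 1) * e / 2) ^ 2 / (((i : ℝ) + 1) ^ 2 * e)))

theorem quadVarTerm_nonneg {e : ℝ} (he : 0 < e) (i : ℕ) : 0 ≤ quadVarTerm e i := by
  have := lacunaryCoeff_nonneg i
  unfold quadVarTerm
  positivity

theorem quadVarTerm_le_inv_sq {e : ℝ} (he : 0 < e) (i : ℕ) :
    quadVarTerm e i ≤ 4 * Real.pi / e * ((((i + 1 : ℕ) : ℝ)) ^ 2)⁻¹ := by
  have h1 := Real.sin_sq_le_one (((i : ℝ) + 1) * e / 2)
  have h2 := lacunaryCoeff_le_one i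
  calc quadVarTerm e i ≤ 4 * Real.pi * (1 * (1 / (((i : ℝ) + 1) ^ 2 * e))) := by
        unfold quadVarTerm
        gcongr
    _ = _ := by
        push_cast
        field_simp

theorem quadVarTerm_le {e : ℝ} (he : 0 < e) (i : ℕ) : quadVarTerm e i ≤ Real.pi * e := by
  have h1 : Real.sin (((i : ℝ) + 1) * e / 2) ^ 2 ≤ (((i : ℝ) + 1) * e / 2) ^ 2 :=
    Real.sin_sq_le_sq
  have h2 := lacunaryCoeff_le_one i
  calc quadVarTerm e i
      ≤ 4 * Real.pi * (1 * ((((i : ℝ) + 1) * e / 2) ^ 2 / (((i : ℝ) + 1) ^ 2 * e))) := by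
        unfold quadVarTerm
        gcongr
    _ = _ := by field_simp; ring

theorem summable_quadVarTerm {e : ℝ} (he : 0 < e) : Summable (quadVarTerm e) := by
  have h : Summable fun i : ℕ => ((((i + 1 : ℕ) : ℝ)) ^ 2)⁻¹ :=
    (summable_nat_add_iff (f := fun n : ℕ => ((n : ℝ) ^ 2)⁻¹) 1).2
      (Real.summable_nat_pow_inv.2 (by norm_num))
  exact Summable.of_nonneg_of_le (quadVarTerm_nonneg he) (quadVarTerm_le_inv_sq he)
    (h.mul_left (4 * Real.pi / e))

/-- In block `k` the argument of the sine lies in `[1/2, 1]`, so by Jordan's inequality each of the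
`2^(k²)` terms is at least a constant times `e = 2^(-k²)`. -/
theorem inv_pi_le_tsum_quadVarTerm (k : ℕ) :
    1 / Real.pi ≤ ∑' i, quadVarTerm (1 / 2 ^ k ^ 2) i := by
  have he : (0 : ℝ) < 1 / 2 ^ k ^ 2 := by positivity
  refine le_trans ?_ ((summable_quadVarTerm he).sum_le_tsum (lacunaryBlock k)
    fun i _ => quadVarTerm_nonneg he i)
  have hterm : ∀ i ∈ lacunaryBlock k, 1 / Real.pi * (1 / 2 ^ k ^ 2) ≤
      quadVarTerm (1 / 2 ^ k ^ 2) i := by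
    intro i hi
    have hM : (0 : ℝ) < 2 ^ k ^ 2 := by positivity
    have h1 : (2 : ℝ) ^ k ^ 2 ≤ (i : ℝ) + 1 := by exact_mod_cast (mem_lacunaryBlock.1 hi).1
    have h2 : (i : ℝ) + 1 ≤ 2 * 2 ^ k ^ 2 := by
      have := (mem_lacunaryBlock.1 hi).2.le
      rw [pow_succ, mul_comm] at this
      exact_mod_cast this
    set x : ℝ := ((i : ℝ) + 1) * (1 / 2 ^ k ^ 2) / 2 with hx
    have hx1 : 1 / 2 ≤ x := by
      rw [hx, mul_one_div, div_le_div_iff_of_pos_right (by norm_num), one_le_div hM]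
      exact h1
    have hx2 : x ≤ 1 := by
      rw [hx, mul_one_div, div_div, div_le_one (by positivity)]
      linarith
    have hsin : 2 / Real.pi * x ≤ Real.sin x :=
      Real.mul_le_sin (by linarith) (by linarith [Real.pi_gt_three])
    have hsin2 : (2 / Real.pi * x) ^ 2 ≤ Real.sin x ^ 2 := by
      have : 0 ≤ 2 / Real.pi * x := by positivity
      gcongr
    have hi0 : (0 : ℝ) < (i : ℝ) + 1 := by positivity
    calc 1 / Real.pi * (1 / 2 ^ k ^ 2) ≤ 4 / Real.pi * (1 / 2 ^ k ^ 2) := by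
          gcongr
          norm_num
      _ = 4 * Real.pi * ((2 / Real.pi * x) ^ 2 / (((i : ℝ) + 1) ^ 2 * (1 / 2 ^ k ^ 2))) := by
          rw [hx]
          field_simp
      _ ≤ _ := by
          rw [quadVarTerm, lacunaryCoeff_of_mem hi, one_mul]
          gcongr
  refine le_trans (le_of_eq ?_) (Finset.sum_le_sum hterm)
  rw [Finset.sum_const, card_lacunaryBlock, nsmul_eq_mul]
  push_cast
  field_simp

theorem tsum_quadVarTerm_le (k : ℕ) :
    ∑' i, quadVarTerm (1 / 2 ^ (k ^ 2 + k + 1)) i ≤ 9 * Real.pi * (1 / 2) ^ k := by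
  set e : ℝ := 1 / 2 ^ (k ^ 2 + k + 1) with hedef
  have he : 0 < e := by positivity
  set a : ℕ := 2 ^ (k ^ 2 + 1) with ha
  set b : ℕ := 2 ^ (k + 1) ^ 2 with hb
  have hb1 : 1 ≤ b := Nat.one_le_two_pow
  -- Below the gap `sin² x ≤ x²` is used, above it `sin² ≤ 1`; inside it the coefficient vanishes.
  -- The two sums give `π 2^(-k)` and `8π 2^(-k)`.
  have hterm : ∀ i, quadVarTerm e i ≤ (if i < a then Real.pi * e else 0) +
      (if b ≤ i + 1 then 4 * Real.pi / e * ((((i + 1 : ℕ) : ℝ)) ^ 2)⁻¹ else 0) := by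
    intro i
    have hnn : 0 ≤ 4 * Real.pi / e * ((((i + 1 : ℕ) : ℝ)) ^ 2)⁻¹ := by positivity
    by_cases h1 : i < a
    · rw [if_pos h1]
      have := quadVarTerm_le he i
      split_ifs <;> linarith
    · rw [if_neg h1, zero_add]
      by_cases h2 : b ≤ i + 1
      · rw [if_pos h2]
        exact quadVarTerm_le_inv_sq he i
      · rw [if_neg h2, quadVarTerm, lacunaryCoeff_of_gap (k := k) (by omega) (by omega)]
        simp
  refine (summable_quadVarTerm he).tsum_le_of_sum_range_le fun n => ?_
  refine (Finset.sum_le_sum fun i _ => hterm i).trans ?_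
  rw [Finset.sum_add_distrib, ← Finset.sum_filter, ← Finset.sum_filter]
  have hfirst : ∑ i ∈ Finset.range n with i < a, Real.pi * e ≤ a * (Real.pi * e) := by
    rw [Finset.sum_const, nsmul_eq_mul]
    gcongr
    calc (Finset.filter (fun i => i < a) (Finset.range n)).card ≤ (Finset.range a).card := by
          refine Finset.card_le_card fun i hi => ?_
          simp only [Finset.mem_filter, Finset.mem_range] at hi ⊢
          exact hi.2
      _ = a := Finset.card_range a
  have hsecond : ∑ i ∈ Finset.range n with b ≤ i + 1,
      4 * Real.pi / e * ((((i + 1 : ℕ) : ℝ)) ^ 2)⁻¹ ≤ 4 * Real.pi / e * (2 / b) := by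
    rw [← Finset.mul_sum]
    gcongr
    -- Starting the open interval at `b - 1` makes the tail estimate exactly `2 / b`.
    have himg : ∑ i ∈ Finset.range n with b ≤ i + 1, ((((i + 1 : ℕ) : ℝ)) ^ 2)⁻¹ =
        ∑ j ∈ Finset.Ioo (b - 1) (n + 1), ((j : ℝ) ^ 2)⁻¹ := by
      refine Finset.sum_bij (fun i _ => i + 1) ?_ ?_ ?_ ?_
      · intro i hi
        simp only [Finset.mem_filter, Finset.mem_range, Finset.mem_Ioo] at hi ⊢
        omega
      · intro i _ j _ h
        omega
      · intro j hj
        simp only [Finset.mem_Ioo] at hj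
        refine ⟨j - 1, ?_, by omega⟩
        simp only [Finset.mem_filter, Finset.mem_range]
        omega
      · intro i _
        rfl
    rw [himg]
    refine (sum_Ioo_inv_sq_le (b - 1) (n + 1)).trans (le_of_eq ?_)
    rw [Nat.cast_sub hb1]
    simp
  refine (add_le_add hfirst hsecond).trans (le_of_eq ?_)
  rw [ha, hb, hedef]
  push_cast
  have e1 : (2 : ℝ) ^ (k ^ 2 + k + 1) = 2 ^ (k ^ 2 + 1) * 2 ^ k := by rw [← pow_add]; ring_nf
  have e2 : (2 : ℝ) ^ (k + 1) ^ 2 = 2 ^ (k ^ 2 + 1) * 2 ^ k * 2 ^ k := by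
    rw [← pow_add, ← pow_add]; ring_nf
  rw [e1, e2, one_div_pow]
  field_simp
  ring

theorem tendsto_one_div_two_pow {f : ℕ → ℕ} (hf : ∀ k, k ≤ f k) :
    Tendsto (fun k : ℕ => (1 : ℝ) / 2 ^ f k) atTop (𝓝[>] 0) := by
  refine tendsto_nhdsWithin_iff.2 ⟨?_, Eventually.of_forall fun k => by
    simp only [mem_Ioi]; positivity⟩
  have h := (tendsto_pow_atTop_nhds_zero_of_lt_one (r := (1 / 2 : ℝ)) (by norm_num)
    (by norm_num)).comp (tendsto_atTop_mono hf tendsto_id)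
  refine h.congr fun k => ?_
  simp [Function.comp]

theorem tendsto_tsum_quadVarTerm :
    Tendsto (fun k : ℕ => ∑' i, quadVarTerm (1 / 2 ^ (k ^ 2 + k + 1)) i) atTop (𝓝 0) := by
  refine squeeze_zero (fun k => tsum_nonneg fun i => quadVarTerm_nonneg (by positivity) i)
    tsum_quadVarTerm_le ?_
  simpa using (tendsto_pow_atTop_nhds_zero_of_lt_one (r := (1 / 2 : ℝ)) (by norm_num)
    (by norm_num)).const_mul (9 * Real.pi)

theorem not_tendsto_of_eventually_eq_tsum_quadVarTerm {q : ℝ → ℝ}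
    (hq : ∀ᶠ e in 𝓝[>] (0 : ℝ), q e = ∑' i, quadVarTerm e i) :
    ¬ ∃ l : EReal, Tendsto (fun e => (q e : EReal)) (𝓝[>] 0) (𝓝 l) := by
  rintro ⟨l, hl⟩
  have hl' : Tendsto (fun e => ((∑' i, quadVarTerm e i : ℝ) : EReal)) (𝓝[>] 0) (𝓝 l) :=
    hl.congr' (by filter_upwards [hq] with e he; rw [he])
  have h1 := hl'.comp (tendsto_one_div_two_pow (f := fun k => k ^ 2 + k + 1) fun k => by nlinarith)
  have h2 := hl'.comp (tendsto_one_div_two_pow (f := fun k => k ^ 2) fun k =>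
    Nat.le_self_pow (by norm_num) k)
  have h3 : l = ((0 : ℝ) : EReal) := tendsto_nhds_unique h1
    ((continuous_coe_real_ereal.tendsto 0).comp tendsto_tsum_quadVarTerm)
  have h4 : ((1 / Real.pi : ℝ) : EReal) ≤ l := ge_of_tendsto' h2 fun k =>
    EReal.coe_le_coe_iff.2 (inv_pi_le_tsum_quadVarTerm k)
  rw [h3, EReal.coe_le_coe_iff] at h4
  exact absurd h4 (not_le.2 (by positivity))

/-- Convergence in probability gives almost sure convergence along subsequences of both step
sequences; at one common `ω` the two deterministic limits contradict each other. -/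
theorem not_tendstoInMeasure_of_ae_eq_tsum_quadVarTerm {Ω : Type*} [MeasurableSpace Ω]
    {P : Measure Ω} [IsProbabilityMeasure P] {q : ℝ → Ω → ℝ} {e₀ : ℝ} (he₀ : 0 < e₀)
    (hq : ∀ᵐ ω ∂P, ∀ e, 0 < e → e ≤ e₀ → q e ω = ∑' i, quadVarTerm e i) (Y : Ω → ℝ) :
    ¬ TendstoInMeasure P q (𝓝[>] 0) Y := by
  intro h
  have hlim : ∀ u : ℕ → ℝ, Tendsto u atTop (𝓝[>] 0) → ∃ φ : ℕ → ℕ, StrictMono φ ∧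
      ∀ᵐ ω ∂P, Tendsto (fun k => ∑' i, quadVarTerm (u (φ k)) i) atTop (𝓝 (Y ω)) := by
    intro u hu
    obtain ⟨φ, hφ, hφ'⟩ := (h.comp hu).exists_seq_tendsto_ae
    refine ⟨φ, hφ, ?_⟩
    filter_upwards [hφ', hq] with ω h1 h2
    refine h1.congr' ?_
    have hmem : ∀ᶠ e in 𝓝[>] (0 : ℝ), e ∈ Ioc 0 e₀ := Ioc_mem_nhdsGT he₀
    filter_upwards [(hu.comp hφ.tendsto_atTop).eventually hmem] with k hk
    exact h2 _ hk.1 hk.2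
  obtain ⟨φ, hφ, h1⟩ := hlim _ (tendsto_one_div_two_pow (f := fun k => k ^ 2 + k + 1)
    fun k => by nlinarith)
  obtain ⟨ψ, hψ, h2⟩ := hlim _ (tendsto_one_div_two_pow (f := fun k => k ^ 2) fun k =>
    Nat.le_self_pow (by norm_num) k)
  obtain ⟨ω, h1, h2⟩ := (h1.and h2).exists
  have h3 : Y ω = 0 := tendsto_nhds_unique h1 (tendsto_tsum_quadVarTerm.comp hφ.tendsto_atTop)
  have h4 : 1 / Real.pi ≤ Y ω := ge_of_tendsto' h2 fun k => inv_pi_le_tsum_quadVarTerm (ψ k)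
  rw [h3] at h4
  exact absurd h4 (not_le.2 (by positivity))

theorem HasFiniteQuadraticVariation.tendstoInMeasure {Ω : Type*} [MeasurableSpace Ω]
    {P : Measure Ω} {X : ℝ → Ω → ℝ} {T : ℝ} (hT : 0 ≤ T) (h : HasFiniteQuadraticVariation P X T) :
    ∃ Y : Ω → ℝ, TendstoInMeasure P (fun e => quadVar X T e) (𝓝[>] 0) Y := by
  obtain ⟨V, hV⟩ := h
  refine ⟨V T, tendstoInMeasure_iff_norm.2 fun δ hδ => ?_⟩
  refine tendsto_of_tendsto_of_tendsto_of_le_of_le tendsto_const_nhds (hV δ hδ)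
    (fun _ => zero_le) fun e => measure_mono fun ω hω => ?_
  exact ⟨T, ⟨hT, le_rfl⟩, hω⟩

/-- **Parseval's identity** for the increments of the random series. -/
theorem IsTame.integral_sq_increment {R : ℕ → ℝ} (hR : ∀ i, R i = 1 ∨ R i = -1) {N : ℕ}
    (h : IsTame R N) {e : ℝ} (he : 0 < e) (heN : 2 * Real.pi + e ≤ N) {f : ℝ → ℝ}
    (hf : ∀ s ∈ Icc (0 : ℝ) (2 * Real.pi + e), f s = ∑' k, blockSum R k s) :
    (1 / e) * ∫ s in (0 : ℝ)..2 * Real.pi, (f (s + e) - f s) ^ 2 = ∑' i, quadVarTerm e i := by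
  have hpi := Real.pi_pos
  have hmem : ∀ s ∈ uIoc (0 : ℝ) (2 * Real.pi), s ∈ Icc (0 : ℝ) N ∧ s + e ∈ Icc (0 : ℝ) N ∧
      s ∈ Icc (0 : ℝ) (2 * Real.pi + e) ∧ s + e ∈ Icc (0 : ℝ) (2 * Real.pi + e) := by
    intro s hs
    rw [uIoc_of_le (by positivity)] at hs
    refine ⟨⟨?_, ?_⟩, ⟨?_, ?_⟩, ⟨?_, ?_⟩, ?_, ?_⟩ <;> linarith [hs.1, hs.2]
  let u : ℕ → ℝ → ℝ := fun K s =>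
    ∑ k ∈ Finset.range K, (blockSum R k (s + e) - blockSum R k s)
  have hcont : ∀ k, Continuous (blockSum R k) := fun k =>
    continuous_iff_continuousAt.2 fun s => (hasDerivAt_blockSum R k s).continuousAt
  have hucont : ∀ K, Continuous (u K) := fun K => by
    have := hcont
    fun_prop
  have hlim : ∀ s ∈ uIoc (0 : ℝ) (2 * Real.pi),
      Tendsto (fun K => u K s) atTop (𝓝 (f (s + e) - f s)) := by
    intro s hs
    obtain ⟨m1, m2, m3, m4⟩ := hmem s hs
    rw [hf _ m4, hf _ m3]
    exact ((h.summable_blockSum m2).hasSum.sub (h.summable_blockSum m1).hasSum).tendsto_sum_nat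
  -- The difference of sines is a cosine at the midpoint `s + e/2`, which makes the terms orthogonal
  -- over a period.
  have hformula : ∀ K s, u K s = ∑ i ∈ Finset.range (2 ^ K ^ 2 - 1),
      (lacunaryCoeff i * (R i * (2 * Real.sin (((i : ℝ) + 1) * e / 2) / ((i : ℝ) + 1)))) *
        Real.cos (((i : ℝ) + 1) * (s + e / 2)) := by
    intro K s
    simp_rw [mul_assoc (lacunaryCoeff _)]
    rw [sum_range_lacunaryCoeff_mul]
    refine Finset.sum_congr rfl fun k _ => ?_
    rw [blockSum, blockSum, ← Finset.sum_sub_distrib]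
    refine Finset.sum_congr rfl fun i _ => ?_
    rw [← mul_sub, ← sub_div, Real.sin_sub_sin]
    have e1 : (((i : ℝ) + 1) * (s + e) - ((i : ℝ) + 1) * s) / 2 = ((i : ℝ) + 1) * e / 2 := by ring
    have e2 : (((i : ℝ) + 1) * (s + e) + ((i : ℝ) + 1) * s) / 2 = ((i : ℝ) + 1) * (s + e / 2) := by
      ring
    rw [e1, e2]
    ring
  have hint : ∀ K, (1 / e) * ∫ s in (0 : ℝ)..2 * Real.pi, u K s ^ 2 =
      ∑ i ∈ Finset.range (2 ^ K ^ 2 - 1), quadVarTerm e i := by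
    intro K
    simp_rw [hformula]
    have h1 := integral_sq_sum_cos_period 1 (Finset.range (2 ^ K ^ 2 - 1)) (fun i =>
      lacunaryCoeff i * (R i * (2 * Real.sin (((i : ℝ) + 1) * e / 2) / ((i : ℝ) + 1)))) (e / 2)
    rw [Nat.cast_one, mul_one, mul_one] at h1
    rw [h1, ← mul_assoc, Finset.mul_sum]
    refine Finset.sum_congr rfl fun i _ => ?_
    have hR2 : R i ^ 2 = 1 := by rcases hR i with h | h <;> simp [h]
    rw [mul_pow, mul_pow, lacunaryCoeff_sq, hR2, quadVarTerm]
    field_simp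
    ring
  obtain ⟨C, hC, hbound⟩ := h
  -- Tameness yields a constant dominating function, so Parseval passes to the limit for every `e`
  -- on the same event.
  set B : ℝ := ∑' k : ℕ, 2 * C * (((k : ℝ) + 1) / Real.sqrt (2 ^ k ^ 2)) with hB
  have hdom : ∀ K, ∀ s ∈ uIoc (0 : ℝ) (2 * Real.pi), |u K s| ≤ B := by
    intro K s hs
    obtain ⟨m1, m2, -, -⟩ := hmem s hs
    calc |u K s| ≤ ∑ k ∈ Finset.range K, |blockSum R k (s + e) - blockSum R k s| :=
          Finset.abs_sum_le_sum_abs _ _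
      _ ≤ ∑ k ∈ Finset.range K, 2 * C * (((k : ℝ) + 1) / Real.sqrt (2 ^ k ^ 2)) := by
          refine Finset.sum_le_sum fun k _ => (abs_sub _ _).trans ?_
          linarith [(hbound k _ m1).1, (hbound k _ m2).1]
      _ ≤ B := (summable_block_inv_sqrt.mul_left (2 * C)).sum_le_tsum _ fun k _ => by positivity
  have hconv : Tendsto (fun K => (1 / e) * ∫ s in (0 : ℝ)..2 * Real.pi, u K s ^ 2) atTop
      (𝓝 ((1 / e) * ∫ s in (0 : ℝ)..2 * Real.pi, (f (s + e) - f s) ^ 2)) := by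
    refine Tendsto.const_mul _ (intervalIntegral.tendsto_integral_filter_of_dominated_convergence
      (fun _ => B ^ 2) ?_ ?_ ?_ ?_)
    · exact Eventually.of_forall fun K => ((hucont K).pow 2).aestronglyMeasurable
    · refine Eventually.of_forall fun K => ae_of_all _ fun s hs => ?_
      rw [Real.norm_eq_abs, abs_pow]
      exact pow_le_pow_left₀ (abs_nonneg _) (hdom K s hs) 2
    · exact intervalIntegrable_const
    · exact ae_of_all _ fun s hs => (hlim s hs).pow 2
  simp_rw [hint] at hconv
  exact tendsto_nhds_unique hconv
    ((summable_quadVarTerm he).hasSum.tendsto_sum_nat.comp tendsto_two_pow_sq_sub_one)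

/-! ### The random cosine series as a stochastic measure. -/

section RandomMeasure

variable {Ω : Type*} [MeasurableSpace Ω] {P : Measure Ω} [IsProbabilityMeasure P] {r : ℕ → Ω → ℝ}

theorem sum_sq_lacunaryCoeff_mul_setIntegral_cos_le (K : ℕ) {A : Set ℝ}
    (hAK : A ⊆ Icc 0 (2 * Real.pi * K)) (n : ℕ) :
    ∑ i ∈ Finset.range n, (lacunaryCoeff i * ∫ t in A, Real.cos (((i : ℝ) + 1) * t)) ^ 2 ≤
      Real.pi * K * volume.real A := by
  refine le_trans (Finset.sum_le_sum fun i _ => ?_) (sum_sq_setIntegral_cos_le K _ hAK)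
  rw [mul_pow, lacunaryCoeff_sq]
  exact mul_le_of_le_one_left (sq_nonneg _) (lacunaryCoeff_le_one i)

/-- `m` is the sum of the random series of cosine integrals over `A`. -/
def IsCosineSeriesSum (P : Measure Ω) (r : ℕ → Ω → ℝ) (A : Set ℝ) (m : Ω → ℝ) : Prop :=
  ∀ᵐ ω ∂P, Tendsto (fun n : ℕ => ∑ i ∈ Finset.range n,
    lacunaryCoeff i * r i ω * ∫ t in A, Real.cos (((i : ℝ) + 1) * t)) atTop (𝓝 (m ω))

omit [IsProbabilityMeasure P] in
theorem isCosineSeriesSum_iff {A : Set ℝ} {m : Ω → ℝ} :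
    IsCosineSeriesSum P r A m ↔ ∀ᵐ ω ∂P, Tendsto (fun n : ℕ => ∑ i ∈ Finset.range n,
      (lacunaryCoeff i * ∫ t in A, Real.cos (((i : ℝ) + 1) * t)) * r i ω) atTop (𝓝 (m ω)) := by
  simp_rw [IsCosineSeriesSum, mul_right_comm]

theorem IsRademacherSequence.exists_isCosineSeriesSum (hr : IsRademacherSequence P r) (K : ℕ) :
    ∃ μ : Set ℝ → Ω →ₘ[P] ℝ, ∀ A ⊆ Icc 0 (2 * Real.pi * K), IsCosineSeriesSum P r A (μ A) := by
  have h : ∀ A : Set ℝ, ∃ m : Ω →ₘ[P] ℝ, A ⊆ Icc 0 (2 * Real.pi * K) →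
      IsCosineSeriesSum P r A m := by
    intro A
    by_cases hA : A ⊆ Icc 0 (2 * Real.pi * K)
    · obtain ⟨L, hLm, hL⟩ := hr.exists_ae_tendsto
        (sum_sq_lacunaryCoeff_mul_setIntegral_cos_le K hA)
      refine ⟨AEEqFun.mk L hLm.aestronglyMeasurable, fun _ => isCosineSeriesSum_iff.2 ?_⟩
      filter_upwards [hL, AEEqFun.coeFn_mk L hLm.aestronglyMeasurable] with ω h1 h2
      rwa [h2]
    -- Default value for sets outside the interval.
    · exact ⟨0, fun h => absurd h hA⟩
  choose μ hμ using h
  exact ⟨μ, hμ⟩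

theorem setIntegral_iUnion_eq_sum_add {A : ℕ → Set ℝ} (hA : ∀ k, MeasurableSet (A k))
    (hd : Pairwise (Function.onFun Disjoint A)) {f : ℝ → ℝ} (hf : IntegrableOn f (⋃ k, A k))
    (n : ℕ) :
    ∫ t in ⋃ k, A k, f t = ∑ k ∈ Finset.range n, (∫ t in A k, f t) +
      ∫ t in ⋃ k ∈ Ici n, A k, f t := by
  have hunion : (⋃ k, A k) = (⋃ k ∈ Finset.range n, A k) ∪ ⋃ k ∈ Ici n, A k := by
    ext t
    simp only [mem_iUnion, mem_union, Finset.mem_range, mem_Ici, exists_prop]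
    constructor
    · rintro ⟨k, hk⟩
      exact (lt_or_ge k n).imp (fun h => ⟨k, h, hk⟩) fun h => ⟨k, h, hk⟩
    · rintro (⟨k, -, hk⟩ | ⟨k, -, hk⟩) <;> exact ⟨k, hk⟩
  have hdisj : Disjoint (⋃ k ∈ Finset.range n, A k) (⋃ k ∈ Ici n, A k) := by
    simp only [disjoint_iUnion_left, disjoint_iUnion_right]
    intro i hi j hj
    rw [mem_Ici] at hi
    rw [Finset.mem_range] at hj
    exact hd (by omega)
  rw [hunion, setIntegral_union hdisj (MeasurableSet.biUnion (to_countable _) fun k _ => hA k)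
    (hf.mono_set (hunion ▸ subset_union_left)) (hf.mono_set (hunion ▸ subset_union_right)),
    integral_biUnion_finset _ (fun k _ => hA k) (fun i _ j _ hij => hd hij)
      fun k _ => hf.mono_set (subset_iUnion A k)]

theorem IsRademacherSequence.isStochasticMeasureOn (hr : IsRademacherSequence P r) {K : ℕ}
    {μ : Set ℝ → Ω →ₘ[P] ℝ} (hμ : ∀ A ⊆ Icc 0 (2 * Real.pi * K), IsCosineSeriesSum P r A (μ A))
    {S : Set ℝ} (hS : S ⊆ Icc 0 (2 * Real.pi * K)) : IsStochasticMeasureOn P S μ := by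
  intro A hA hd
  have hAK : ∀ k, A k ⊆ Icc 0 (2 * Real.pi * K) := fun k => (hA k).2.trans hS
  have hU : (⋃ k, A k) ⊆ Icc 0 (2 * Real.pi * K) := iUnion_subset hAK
  have hB : ∀ n, (⋃ k ∈ Ici n, A k) ⊆ Icc 0 (2 * Real.pi * K) := fun n =>
    iUnion₂_subset fun k _ => hAK k
  have hcoe : ∀ n : ℕ, ((∑ k ∈ Finset.range n, μ (A k) : Ω →ₘ[P] ℝ) : Ω → ℝ) =ᵐ[P]
      fun ω => ∑ k ∈ Finset.range n, μ (A k) ω := by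
    intro n
    induction n with
    | zero =>
      simp only [Finset.range_zero, Finset.sum_empty]
      exact AEEqFun.coeFn_zero
    | succ n ih =>
      rw [Finset.sum_range_succ]
      filter_upwards [ih, AEEqFun.coeFn_add (∑ k ∈ Finset.range n, μ (A k)) (μ (A n))] with ω h1 h2
      rw [h2, Pi.add_apply, h1, Finset.sum_range_succ]
  -- Finite additivity holds for each partial sum of the series, hence almost surely in the limit;
  -- the error is `μ` of the tail union, whose volume tends to `0`.
  have hdiff : ∀ n : ℕ, (((∑ k ∈ Finset.range n, μ (A k) : Ω →ₘ[P] ℝ) : Ω → ℝ) -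
      (μ (⋃ k, A k) : Ω → ℝ)) =ᵐ[P] -(μ (⋃ k ∈ Ici n, A k) : Ω → ℝ) := by
    intro n
    filter_upwards [hcoe n, hμ _ hU, hμ _ (hB n), ae_all_iff.2 fun k => hμ _ (hAK k)]
      with ω h1 h2 h3 h4
    have h5 := (tendsto_finsetSum (Finset.range n) fun k _ => h4 k).add h3
    have h6 : μ (⋃ k, A k) ω = ∑ k ∈ Finset.range n, μ (A k) ω + μ (⋃ k ∈ Ici n, A k) ω := by
      refine tendsto_nhds_unique h2 (h5.congr fun j => ?_)
      rw [Finset.sum_comm, ← Finset.sum_add_distrib]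
      refine Finset.sum_congr rfl fun i _ => ?_
      rw [setIntegral_iUnion_eq_sum_add (fun k => (hA k).1) hd
        ((Continuous.continuousOn (by fun_prop)).integrableOn_Icc.mono_set hU) n, mul_add,
        Finset.mul_sum]
    rw [Pi.sub_apply, Pi.neg_apply, h1, h6]
    ring
  refine tendstoInMeasure_of_tendsto_eLpNorm (p := 2) (by norm_num)
    (fun n => AEEqFun.aestronglyMeasurable _) (AEEqFun.aestronglyMeasurable _) ?_
  have hle : ∀ n : ℕ, eLpNorm (((∑ k ∈ Finset.range n, μ (A k) : Ω →ₘ[P] ℝ) : Ω → ℝ) -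
      (μ (⋃ k, A k) : Ω → ℝ)) 2 P ≤
      ENNReal.ofReal (Real.sqrt (Real.pi * K * volume.real (⋃ k ∈ Ici n, A k))) := by
    intro n
    rw [eLpNorm_congr_ae (hdiff n), eLpNorm_neg]
    exact hr.eLpNorm_limit_le (sum_sq_lacunaryCoeff_mul_setIntegral_cos_le K (hB n))
      (isCosineSeriesSum_iff.1 (hμ _ (hB n)))
  refine tendsto_of_tendsto_of_tendsto_of_le_of_le tendsto_const_nhds ?_ (fun _ => zero_le) hle
  have hfin : volume (⋃ k, A k) ≠ ⊤ := ((measure_mono hU).trans_lt measure_Icc_lt_top).ne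
  have hvol : Tendsto (fun n => volume (⋃ k ∈ Ici n, A k)) atTop (𝓝 0) := by
    have hfinm : IsFiniteMeasure (volume.restrict (⋃ k, A k)) :=
      isFiniteMeasure_restrict.2 hfin
    have h := tendsto_measure_biUnion_Ici_zero_of_pairwise_disjoint
      (μ := volume.restrict (⋃ k, A k)) (fun k => (hA k).1.nullMeasurableSet) hd
    refine h.congr fun n => Measure.restrict_eq_self _ (iUnion₂_subset fun k _ => subset_iUnion A k)
  have hreal := (ENNReal.tendsto_toReal ENNReal.zero_ne_top).comp hvol
  have h := ENNReal.tendsto_ofReal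
    ((Real.continuous_sqrt.tendsto _).comp (hreal.const_mul (Real.pi * K)))
  simpa [Measure.real] using h

end RandomMeasure

/-! ### The regular version of the process and the conclusion. -/

theorem setIntegral_Ioc_cos {s : ℝ} (hs : 0 ≤ s) (i : ℕ) :
    ∫ t in Ioc 0 s, Real.cos (((i : ℝ) + 1) * t) =
      Real.sin (((i : ℝ) + 1) * s) / ((i : ℝ) + 1) := by
  have hi : ((i : ℝ) + 1) ≠ 0 := by positivity
  rw [← intervalIntegral.integral_of_le hs, intervalIntegral.integral_comp_mul_left _ hi,
    integral_cos]
  simp [div_eq_inv_mul]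

theorem IsTame.tsum_blockSum_eq {R : ℕ → ℝ} {N : ℕ} (h : IsTame R N) {s : ℝ}
    (hs : s ∈ Icc (0 : ℝ) N) {l : ℝ}
    (hl : Tendsto (fun n : ℕ => ∑ i ∈ Finset.range n,
      lacunaryCoeff i * R i * (Real.sin (((i : ℝ) + 1) * s) / ((i : ℝ) + 1))) atTop (𝓝 l)) :
    ∑' k, blockSum R k s = l := by
  refine tendsto_nhds_unique (h.summable_blockSum hs).hasSum.tendsto_sum_nat
    ((hl.comp tendsto_two_pow_sq_sub_one).congr fun K => ?_)
  simp_rw [Function.comp_apply, mul_assoc]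
  exact sum_range_lacunaryCoeff_mul _ K

open Classical in
/-- The process `s ↦ ∑ₖ blockSum k s` on `[0, T]`, put equal to `0` on the exceptional set `Z`. -/
noncomputable def blockProcess {Ω : Type*} (r : ℕ → Ω → ℝ) (Z : Set Ω) (T s : ℝ) (ω : Ω) : ℝ :=
  if s ∈ Icc 0 T ∧ ω ∉ Z then ∑' k, blockSum (fun i => r i ω) k s else 0

section BlockProcess

variable {Ω : Type*} {r : ℕ → Ω → ℝ} {Z : Set Ω} {T : ℝ} {N : ℕ}

theorem measurable_blockProcess [MeasurableSpace Ω] (hr : ∀ i, Measurable (r i))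
    (hZ : MeasurableSet Z) (htame : ∀ ω ∉ Z, IsTame (fun i => r i ω) N) (hTN : T ≤ N) (s : ℝ) :
    Measurable (blockProcess r Z T s) := by
  by_cases hs : s ∈ Icc 0 T
  · have hm : ∀ K : ℕ, Measurable
        (Zᶜ.indicator fun ω => ∑ k ∈ Finset.range K, blockSum (fun i => r i ω) k s) := by
      intro K
      refine Measurable.indicator ?_ hZ.compl
      unfold blockSum
      fun_prop
    refine measurable_of_tendsto_metrizable hm (tendsto_pi_nhds.2 fun ω => ?_)
    by_cases hω : ω ∈ Z
    · simp [blockProcess, hω]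
    · have h := ((htame ω hω).summable_blockSum ⟨hs.1, hs.2.trans hTN⟩).hasSum.tendsto_sum_nat
      simpa [blockProcess, hω, hs.1, hs.2] using h
  · have : blockProcess r Z T s = fun _ => 0 := by
      ext ω
      simp only [blockProcess, hs, false_and, if_false]
    rw [this]
    exact measurable_const

theorem exists_holderOnWith_blockProcess (htame : ∀ ω ∉ Z, IsTame (fun i => r i ω) N)
    (hTN : T ≤ N) (ω : Ω) {γ : NNReal} (hγ : γ < 1 / 2) :
    ∃ C : NNReal, HolderOnWith C γ (fun s => blockProcess r Z T s ω) (Icc 0 T) := by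
  by_cases hω : ω ∈ Z
  · exact ⟨0, fun s _ t _ => by simp [blockProcess, hω]⟩
  · obtain ⟨C, hC⟩ := (htame ω hω).exists_holderOnWith hγ
    refine ⟨C, fun s hs t ht => ?_⟩
    have h := hC s ⟨hs.1, hs.2.trans hTN⟩ t ⟨ht.1, ht.2.trans hTN⟩
    simpa only [blockProcess, hs, ht, hω, not_false_eq_true, and_self, if_true] using h

theorem quadVar_blockProcess (htame : ∀ ω ∉ Z, IsTame (fun i => r i ω) N) (hTN : T ≤ N) {ω : Ω}
    (hω : ω ∉ Z) (hr : ∀ i, r i ω = 1 ∨ r i ω = -1) {e : ℝ} (he : 0 < e)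
    (heT : e ≤ T - 2 * Real.pi) :
    quadVar (blockProcess r Z T) (2 * Real.pi) e ω = ∑' i, quadVarTerm e i := by
  refine (htame ω hω).integral_sq_increment hr he (by linarith)
    (f := fun s => blockProcess r Z T s ω) fun s hs => ?_
  have hs' : s ∈ Icc 0 T := ⟨hs.1, hs.2.trans (by linarith)⟩
  simp only [blockProcess, hs', hω, not_false_eq_true, and_self, if_true]

end BlockProcess

/- The term with index `i : ℕ` is the term of frequency `i + 1` of the series. -/
theorem mainTheorem6 :
    ∃ α : ℕ → ℝ, (∀ i, α i = 0 ∨ α i = 1) ∧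
      ∀ (Ω : Type*) [MeasurableSpace Ω] (P : Measure Ω) [IsProbabilityMeasure P]
        (r : ℕ → Ω → ℝ), IsRademacherSequence P r →
      ∀ T₁ : ℝ, 2 * Real.pi < T₁ →
      ∃ μ : Set ℝ → Ω →ₘ[P] ℝ,
        -- the series defining `μ A` converges almost surely, and `μ` is a stochastic measure
        (∀ A : Set ℝ, MeasurableSet A → A ⊆ Icc 0 T₁ → ∀ᵐ ω ∂P,
          Tendsto (fun n : ℕ => ∑ i ∈ Finset.range n,
            α i * r i ω * ∫ t in A, Real.cos (((i : ℝ) + 1) * t)) atTop (𝓝 (μ A ω))) ∧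
        IsStochasticMeasureOn P (Icc 0 T₁) μ ∧
        -- `X` is a version of the process `μ_s = μ (0, s]`
        ∃ X : ℝ → Ω → ℝ,
          (∀ s, Measurable (X s)) ∧
          (∀ s ∈ Icc 0 T₁, X s =ᵐ[P] (μ (Ioc 0 s) : Ω → ℝ)) ∧
          (∀ s ∈ Icc 0 T₁, ∀ᵐ ω ∂P,
            Tendsto (fun n : ℕ => ∑ i ∈ Finset.range n,
              α i * r i ω * (Real.sin (((i : ℝ) + 1) * s) / ((i : ℝ) + 1)))
              atTop (𝓝 (X s ω))) ∧
          -- with continuous paths, Hölder of every order below `1/2`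
          (∀ ω, ContinuousOn (fun s => X s ω) (Icc 0 T₁)) ∧
          (∀ ω, ∀ γ : NNReal, γ < 1 / 2 →
            ∃ C : NNReal, HolderOnWith C γ (fun s => X s ω) (Icc 0 T₁)) ∧
          -- its regularised quadratic variation on `[0, 2π]` is deterministic and has no limit
          (∀ᵐ ω ∂P, ∀ e : ℝ, 0 < e → e ≤ T₁ - 2 * Real.pi →
            HasSum (fun i : ℕ => 4 * Real.pi *
              (α i * (Real.sin (((i : ℝ) + 1) * e / 2) ^ 2 / (((i : ℝ) + 1) ^ 2 * e))))
              (quadVar X (2 * Real.pi) e ω)) ∧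
          (∀ᵐ ω ∂P, ¬ ∃ l : EReal,
            Tendsto (fun e : ℝ => (quadVar X (2 * Real.pi) e ω : EReal)) (𝓝[>] 0) (𝓝 l)) ∧
          (¬ ∃ Y : Ω → ℝ,
            TendstoInMeasure P (fun e : ℝ => quadVar X (2 * Real.pi) e) (𝓝[>] 0) Y) ∧
          ¬ HasFiniteQuadraticVariation P X (2 * Real.pi) := by
  refine ⟨lacunaryCoeff, lacunaryCoeff_eq_zero_or_one, ?_⟩
  intro Ω _ P _ r hr T₁ hT
  have hpi := Real.pi_pos
  obtain ⟨K, hK⟩ : ∃ K : ℕ, T₁ ≤ 2 * Real.pi * K := by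
    obtain ⟨K, hK⟩ := exists_nat_ge (T₁ / (2 * Real.pi))
    exact ⟨K, by rwa [div_le_iff₀' (by positivity)] at hK⟩
  obtain ⟨N, hN⟩ := exists_nat_ge T₁
  obtain ⟨μ, hμ⟩ := hr.exists_isCosineSeriesSum K
  have hsub : Icc 0 T₁ ⊆ Icc 0 (2 * Real.pi * K) := Icc_subset_Icc le_rfl hK
  -- Setting the process to `0` on a measurable null set containing the non-tame outcomes keeps it
  -- measurable and makes every path regular.
  obtain ⟨Z, hZsub, hZ, hZ0⟩ := exists_measurable_superset_of_null (hr.ae_isTame N)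
  have htame : ∀ ω ∉ Z, IsTame (fun i => r i ω) N := fun ω hω =>
    not_not.1 fun h => hω (hZsub h)
  have hZae : ∀ᵐ ω ∂P, ω ∉ Z := measure_eq_zero_iff_ae_notMem.1 hZ0
  have hser : ∀ s ∈ Icc 0 T₁, ∀ᵐ ω ∂P, Tendsto (fun n : ℕ => ∑ i ∈ Finset.range n,
      lacunaryCoeff i * r i ω * (Real.sin (((i : ℝ) + 1) * s) / ((i : ℝ) + 1)))
      atTop (𝓝 (μ (Ioc 0 s) ω)) := by
    intro s hs
    have h := hμ (Ioc 0 s) ((Ioc_subset_Icc_self.trans (Icc_subset_Icc le_rfl hs.2)).trans hsub)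
    simpa only [IsCosineSeriesSum, setIntegral_Ioc_cos hs.1] using h
  have hX : ∀ s ∈ Icc 0 T₁, blockProcess r Z T₁ s =ᵐ[P] (μ (Ioc 0 s) : Ω → ℝ) := by
    intro s hs
    filter_upwards [hser s hs, hZae] with ω h1 h2
    rw [blockProcess, if_pos ⟨hs, h2⟩]
    exact (htame ω h2).tsum_blockSum_eq ⟨hs.1, hs.2.trans hN⟩ h1
  have hquad : ∀ᵐ ω ∂P, ∀ e : ℝ, 0 < e → e ≤ T₁ - 2 * Real.pi →
      quadVar (blockProcess r Z T₁) (2 * Real.pi) e ω = ∑' i, quadVarTerm e i := by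
    filter_upwards [hZae, ae_all_iff.2 hr.ae_eq_or] with ω h1 h2 e he heT
    exact quadVar_blockProcess htame hN h1 h2 he heT
  have hnot : ¬ ∃ Y : Ω → ℝ, TendstoInMeasure P
      (fun e : ℝ => quadVar (blockProcess r Z T₁) (2 * Real.pi) e) (𝓝[>] 0) Y := fun ⟨Y, hY⟩ =>
    not_tendstoInMeasure_of_ae_eq_tsum_quadVarTerm (sub_pos.2 hT) hquad Y hY
  refine ⟨μ, fun A _ hA => hμ A (hA.trans hsub), hr.isStochasticMeasureOn hμ hsub,
    blockProcess r Z T₁, measurable_blockProcess hr.measurable hZ htame hN, hX, ?_, ?_,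
    fun ω γ hγ => exists_holderOnWith_blockProcess htame hN ω hγ, ?_, ?_, hnot,
    fun h => hnot (h.tendstoInMeasure (by positivity))⟩
  · intro s hs
    filter_upwards [hser s hs, hX s hs] with ω h1 h2
    rwa [h2]
  · intro ω
    -- Any exponent strictly between `0` and `1/2` gives continuity.
    obtain ⟨C, hC⟩ := exists_holderOnWith_blockProcess htame hN ω (γ := 1 / 4) (by
      rw [← NNReal.coe_lt_coe]; norm_num)
    exact hC.continuousOn (by norm_num)
  · filter_upwards [hquad] with ω h e he heT
    rw [h e he heT]
    exact (summable_quadVarTerm he).hasSum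
  · filter_upwards [hquad] with ω h
    refine not_tendsto_of_eventually_eq_tsum_quadVarTerm ?_
    filter_upwards [Ioc_mem_nhdsGT (sub_pos.2 hT)] with e he
    exact h e he.1 he.2
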